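/- Let $n\ge 3$ be an integer, let $m\ge 1$ be a proper divisor of $n$, put $t=n/m$, and let $\kappa=\prod_{p\mid m}p$ be the squarefree kernel of $m$. Suppose that $\kappa\mid 210$. For $X\ge 1$, the number of positive integers $A\le X$ with $A\equiv -1 \pmod{\kappa^2}$ such that $f(x)=x^n+Ax^m+A$ is monogenic and has non-squarefree discriminant equals $$\frac{X}{\kappa^2\zeta(2)}\prod_{p\mid\kappa}\left(1-p^{-2}\right)^{-1}\prod_{p\nmid t(t-1)\kappa}\left(1-\frac{1}{p^2-1}\right)+O\left(X^{3/4}\right),$$ where $p$ runs over primes and the implied constant depends only on $n$ and $m$. Here a monic polynomial $f\in\mathbb{Z}[x]$ is called monogenic if it is irreducible over $\mathbb{Q}$ and, for a root $\theta$ of $f$, the ring of integers of $\mathbb{Q}(\theta)$ is $\mathbb{Z}[\theta]$. -/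

import Mathlib

open Polynomial

/-- `f ∈ ℤ[x]` is a monogenic polynomial: it is monic, irreducible over `ℚ`, and for the root
`θ` of `f` in the number field `K = ℚ(θ) = ℚ[x]/(f)` the ring of integers of `K` (the integral
closure of `ℤ` in `K`) is `ℤ[θ]`. -/
def IsMonogenicPolynomial (f : ℤ[X]) : Prop :=
  f.Monic ∧ Irreducible (f.map (Int.castRingHom ℚ)) ∧
    integralClosure ℤ (AdjoinRoot (f.map (Int.castRingHom ℚ))) =
      Algebra.adjoin ℤ {AdjoinRoot.root (f.map (Int.castRingHom ℚ))}

/-- The trinomial `x ^ n + A x ^ m + A` over `ℤ`. -/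
noncomputable def trinomial (n m : ℕ) (A : ℤ) : ℤ[X] :=
  X ^ n + C A * X ^ m + C A

/-- The set of positive integers `A ≤ X` such that `A ≡ -1 (mod κ²)`, where `κ` is the squarefree
kernel (the product of the distinct prime divisors) of `m`, and such that `x ^ n + A x ^ m + A` is
monogenic with non-squarefree discriminant. -/
def secondFamily (n m : ℕ) (X : ℝ) : Set ℕ :=
  {A : ℕ | 0 < A ∧ (A : ℝ) ≤ X ∧
    (A : ℤ) ≡ -1 [ZMOD ((UniqueFactorizationMonoid.radical m : ℕ) : ℤ) ^ 2] ∧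
    IsMonogenicPolynomial (trinomial n m A) ∧ ¬ Squarefree (trinomial n m A).discr}

/-- The Euler factor `1 - 1 / (p² - 1)`, indexed by the primes `p` not dividing `N`. -/
noncomputable def eulerFactor (N : ℕ) (p : {p : ℕ // p.Prime ∧ ¬ p ∣ N}) : ℝ :=
  1 - 1 / ((p : ℝ) ^ 2 - 1)

/-! Write n = mt, h(y) = y^t + Ay + A and B = (-t)^t - (t-1)^(t-1) A (`discrForm`), so that f(x) =
h(x^m). For A > 1 in the given residue class, f is monogenic exactly when A is squarefree and p² ∤ B
for every prime p ∤ t(t-1)κ (`isMonogenicPolynomial_trinomial_iff`). The discriminant condition is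
then automatic, since A² divides the discriminant. What remains is a squarefree sieve for the two
linear forms A and B.

Sufficiency. ℤ[θ] is Dedekind if at each prime P over p either f'(θ) ∉ P or p lies in P² locally.
For p | A this is the Eisenstein shape of f. For p | m, f ≡ (v^t - v - 1)^p mod p with v a power of
x, and the obstruction is a zero of ((v+1)^p - v^p - 1)/p at P; for p ≤ 7 this polynomial has so few
irreducible factors that none can vanish there, which is the role of κ | 210. For p ∤ mA, a multiple
root of h mod p must be z = -t/(t-1), and (t-1)^t h(z) ≡ B mod p², so p² ∤ B suffices. Necessity: p²
| A or p² | B yields an integral element P(θ)/p outside ℤ[θ].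

Sieve. Both conditions are detected by Möbius sums over d² | A and e² | B, cut at Y ≈ X^(1/4). Pairs
d, e ≤ Y are counted by the Chinese remainder theorem with total error O(Y²); d > Y costs O(X/Y);
for d ≤ Y < e one has e ≪ X^(1/2), at cost O(X/Y + Y X^(1/2)). The density is an Euler product with
factor 1 at p | κ, 1 - p⁻² at the other p | t(t-1), and 1 - 2p⁻² = (1 - p⁻²)(1 - 1/(p²-1))
elsewhere. -/

/-! ### A local criterion for monogenicity -/

/-- A Noetherian domain is Dedekind as soon as each nonzero prime is locally generated by one
element modulo its square. -/
theorem isDedekindDomain_of_locally_principal_mod_sq {R : Type*} [CommRing R] [IsDomain R]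
    [IsNoetherianRing R]
    (h : ∀ P : Ideal R, P ≠ ⊥ → P.IsPrime →
      ∃ w ∈ P, ∀ x ∈ P, ∃ s, s ∉ P ∧ s * x ∈ Ideal.span {w} ⊔ P ^ 2) :
    IsDedekindDomain R := by
  suffices IsDedekindDomainDvr R from inferInstance
  refine ⟨fun P hP hprime => ?_⟩
  obtain ⟨w, hw, hx⟩ := h P hP hprime
  set L := Localization.AtPrime P
  set φ := algebraMap R L
  have hmax : Ideal.map φ P = IsLocalRing.maximalIdeal L :=
    Localization.AtPrime.map_eq_maximalIdeal
  have : IsNoetherianRing L := IsLocalization.isNoetherianRing P.primeCompl L inferInstance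
  -- In the localization s becomes a unit, so the hypothesis reads 𝔪 ⊆ (w) + 𝔪², and Nakayama
  -- removes 𝔪².
  have hle : IsLocalRing.maximalIdeal L ≤
      Ideal.span {φ w} ⊔ IsLocalRing.maximalIdeal L • IsLocalRing.maximalIdeal L := by
    rw [← hmax, Ideal.map_le_iff_le_comap]
    intro x hxP
    obtain ⟨s, hs, hsx⟩ := hx x hxP
    have hmem : φ (s * x) ∈ Ideal.map φ (Ideal.span {w} ⊔ P ^ 2) := Ideal.mem_map_of_mem φ hsx
    rw [Ideal.map_sup, Ideal.map_span, Set.image_singleton, Ideal.map_pow, map_mul, pow_two] at hmem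
    have hunit : IsUnit (φ s) := IsLocalization.map_units L (⟨s, hs⟩ : P.primeCompl)
    exact (Ideal.unit_mul_mem_iff_mem _ hunit).mp hmem
  have hgen : IsLocalRing.maximalIdeal L ≤ Ideal.span {φ w} :=
    Submodule.le_of_le_smul_of_le_jacobson_bot (IsNoetherian.noetherian _)
      (IsLocalRing.maximalIdeal_le_jacobson _) hle
  have hprin : Submodule.IsPrincipal (IsLocalRing.maximalIdeal L) := by
    refine ⟨⟨φ w, le_antisymm hgen ?_⟩⟩
    rw [← hmax, Submodule.span_singleton_le_iff_mem]
    exact Ideal.mem_map_of_mem φ hw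
  exact ((IsDiscreteValuationRing.TFAE L (IsLocalization.AtPrime.not_isField R hP L)).out 0 4).mpr
    hprin

theorem C_dvd_of_map_zmod_eq_zero {p : ℕ} {q : ℤ[X]}
    (h : q.map (Int.castRingHom (ZMod p)) = 0) : C (p : ℤ) ∣ q := by
  rw [C_dvd_iff_dvd_coeff]
  intro i
  have := congrArg (fun r => coeff r i) h
  simpa [ZMod.intCast_zmod_eq_zero_iff_dvd] using this

/-- Modulo a prime number `p`, every ideal of `ℤ[x]` is generated by one polynomial. -/
theorem exists_eq_mul_add_C_mul {p : ℕ} (hp : p.Prime) (J : Ideal ℤ[X]) :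
    ∃ g ∈ J, ∀ q ∈ J, ∃ k l : ℤ[X], q = g * k + C (p : ℤ) * l := by
  have : Fact p.Prime := ⟨hp⟩
  set φ := mapRingHom (Int.castRingHom (ZMod p))
  have hφ : Function.Surjective φ := map_surjective _ (ZMod.ringHom_surjective _)
  obtain ⟨g', hg'⟩ := (IsPrincipalIdealRing.principal (J.map φ)).principal
  have hg'mem : g' ∈ J.map φ := hg' ▸ Ideal.mem_span_singleton_self g'
  obtain ⟨g, hg, rfl⟩ := (Ideal.mem_map_iff_of_surjective φ hφ).mp hg'mem
  refine ⟨g, hg, fun q hq => ?_⟩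
  have hqmem : φ q ∈ J.map φ := Ideal.mem_map_of_mem φ hq
  rw [hg'] at hqmem
  obtain ⟨k', hk'⟩ := Ideal.mem_span_singleton.mp hqmem
  obtain ⟨k, rfl⟩ := hφ k'
  obtain ⟨l, hl⟩ := C_dvd_of_map_zmod_eq_zero (p := p) (q := q - g * k) (by
    change φ _ = 0
    rw [map_sub, map_mul, hk', sub_self])
  exact ⟨k, l, by rw [← hl]; ring⟩

/-- A prime P over p is (g, p), with g a generator modulo p of its preimage in ℤ[x]. Write f = gk +
pl. If f' ∉ P, differentiating shows k ∉ P, and gk = -pl in R makes p a local generator. If sp ∈ P²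
with s ∉ P, then g generates locally modulo P². -/
theorem isDedekindDomain_of_surjective_polynomial {R : Type*} [CommRing R] [IsDomain R]
    (φ : ℤ[X] →+* R) (hφ : Function.Surjective φ) (f : ℤ[X]) (hf : f.Monic) (hφf : φ f = 0)
    (h : ∀ (P : Ideal R) (p : ℕ), P.IsPrime → p.Prime → (p : R) ∈ P →
      φ (derivative f) ∉ P ∨ ∃ s, s ∉ P ∧ s * (p : R) ∈ P ^ 2) :
    IsDedekindDomain R := by
  have : IsNoetherianRing R := isNoetherianRing_of_surjective _ _ φ hφ
  have hint : Algebra.IsIntegral ℤ R := by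
    have hX : IsIntegral ℤ (φ X) := by
      refine ⟨f, hf, ?_⟩
      have : (eval₂RingHom (algebraMap ℤ R) (φ X)) = φ :=
        ringHom_ext' (RingHom.ext_int _ _) (by rw [coe_eval₂RingHom, eval₂_X])
      rw [← coe_eval₂RingHom, this, hφf]
    refine ⟨fun x => ?_⟩
    obtain ⟨q, rfl⟩ := hφ x
    induction q using Polynomial.induction_on' with
    | add a b ha hb => rw [map_add]; exact ha.add hb
    | monomial n a =>
      rw [← C_mul_X_pow_eq_monomial, map_mul, map_pow]
      refine IsIntegral.mul ?_ (hX.pow n)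
      have : φ (C a) = algebraMap ℤ R a := by simp
      rw [this]
      exact isIntegral_algebraMap
  refine isDedekindDomain_of_locally_principal_mod_sq fun P hP hprime => ?_
  have hcomap : Ideal.comap (algebraMap ℤ R) P ≠ ⊥ := Ideal.IsIntegral.comap_ne_bot ℤ hP
  obtain ⟨p, hp, hpP⟩ : ∃ p : ℕ, p.Prime ∧ (p : R) ∈ P := by
    have hpr : (Ideal.comap (algebraMap ℤ R) P).IsPrime := inferInstance
    obtain ⟨a, ha⟩ := (IsPrincipalIdealRing.principal (Ideal.comap (algebraMap ℤ R) P)).principal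
    have ha' : Ideal.comap (algebraMap ℤ R) P = Ideal.span {a} := ha
    have ha0 : a ≠ 0 := by
      rintro rfl
      exact hcomap (by rw [ha']; simp)
    have hpa : Prime a := by
      rw [ha'] at hpr
      exact (Ideal.span_singleton_prime ha0).mp hpr
    refine ⟨a.natAbs, Int.prime_iff_natAbs_prime.mp hpa, ?_⟩
    have hmem : (a.natAbs : ℤ) ∈ Ideal.comap (algebraMap ℤ R) P := by
      rw [ha', Ideal.mem_span_singleton]
      exact Int.dvd_natAbs.mpr dvd_rfl
    rw [Ideal.mem_comap, map_natCast] at hmem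
    exact hmem
  have hφp : φ (C (p : ℤ)) = p := by simp
  obtain ⟨g, hg, hgJ⟩ := exists_eq_mul_add_C_mul hp (Ideal.comap φ P)
  rw [Ideal.mem_comap] at hg
  have hgen : ∀ x ∈ P, ∃ k l : R, x = φ g * k + p * l := by
    intro x hx
    obtain ⟨q, rfl⟩ := hφ x
    obtain ⟨k, l, hkl⟩ := hgJ q hx
    exact ⟨φ k, φ l, by rw [hkl, map_add, map_mul, map_mul, hφp]⟩
  rcases h P p hprime hp hpP with hd | ⟨s, hs, hsp⟩
  · obtain ⟨k, l, hkl⟩ := hgJ f (by rw [Ideal.mem_comap, hφf]; exact P.zero_mem)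
    refine ⟨p, hpP, fun x hx => ⟨φ k, ?_, ?_⟩⟩
    · intro hk
      apply hd
      rw [hkl]
      simp only [derivative_mul, derivative_C, zero_mul, zero_add, map_add,
        map_mul, hφp]
      exact P.add_mem (P.add_mem (P.mul_mem_left _ hk) (P.mul_mem_right _ hg))
        (P.mul_mem_right _ hpP)
    · obtain ⟨a, b, rfl⟩ := hgen x hx
      refine Ideal.mem_sup_left (Ideal.mem_span_singleton.mpr ⟨- φ l * a + φ k * b, ?_⟩)
      have h0 : φ g * φ k + p * φ l = 0 := by
        rw [← hφf, hkl, map_add, map_mul, map_mul, hφp]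
      linear_combination a * h0
  · refine ⟨φ g, hg, fun x hx => ⟨s, hs, ?_⟩⟩
    obtain ⟨a, b, rfl⟩ := hgen x hx
    have hrw : s * (φ g * a + p * b) = φ g * (a * s) + s * p * b := by ring
    rw [hrw]
    exact Ideal.add_mem _ (Ideal.mem_sup_left (Ideal.mem_span_singleton.mpr ⟨_, rfl⟩))
      (Ideal.mem_sup_right (Ideal.mul_mem_right _ _ hsp))

theorem aeval_root_eq_zero_of_map (f : ℤ[X]) :
    aeval (AdjoinRoot.root (f.map (Int.castRingHom ℚ))) f = 0 := by
  have h := AdjoinRoot.eval₂_root (f.map (Int.castRingHom ℚ))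
  rw [eval₂_map] at h
  rw [aeval_def, ← h]
  exact eval₂_congr (RingHom.ext_int _ _) rfl rfl

theorem exists_smul_eq_aeval_root (f : ℤ[X]) (x : AdjoinRoot (f.map (Int.castRingHom ℚ))) :
    ∃ (N : ℤ) (q : ℤ[X]), N ≠ 0 ∧
      (N : AdjoinRoot (f.map (Int.castRingHom ℚ))) * x = aeval (AdjoinRoot.root _) q := by
  obtain ⟨q, rfl⟩ := AdjoinRoot.mk_surjective x
  obtain ⟨N, hN0, hN⟩ := IsLocalization.integerNormalization_spec (nonZeroDivisors ℤ) q
  refine ⟨N, IsLocalization.integerNormalization (nonZeroDivisors ℤ) q,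
    nonZeroDivisors.ne_zero hN0, ?_⟩
  have h := congrArg (AdjoinRoot.mk (f.map (Int.castRingHom ℚ))) hN
  rw [← AdjoinRoot.aeval_eq, ← AdjoinRoot.aeval_eq, aeval_map_algebraMap] at h
  rw [h, map_zsmul, AdjoinRoot.aeval_eq]
  simp

/-- A local criterion (in the spirit of Dedekind) for a monic irreducible polynomial to be
monogenic. -/
theorem isMonogenicPolynomial_of_local (f : ℤ[X]) (hf : f.Monic)
    (hirr : Irreducible (f.map (Int.castRingHom ℚ)))
    (h : ∀ (R : Type) [CommRing R] [IsDomain R] (a : R), aeval a f = 0 →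
      ∀ (P : Ideal R) (p : ℕ), P.IsPrime → p.Prime → (p : R) ∈ P →
        aeval a (derivative f) ∉ P ∨ ∃ s, s ∉ P ∧ s * (p : R) ∈ P ^ 2) :
    IsMonogenicPolynomial f := by
  refine ⟨hf, hirr, ?_⟩
  have : Fact (Irreducible (f.map (Int.castRingHom ℚ))) := ⟨hirr⟩
  set K := AdjoinRoot (f.map (Int.castRingHom ℚ))
  set θ : K := AdjoinRoot.root (f.map (Int.castRingHom ℚ))
  set S := Algebra.adjoin ℤ {θ}
  have hθS : θ ∈ S := Algebra.self_mem_adjoin_singleton ℤ θ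
  set a : S := ⟨θ, hθS⟩
  have hcoe : ∀ q : ℤ[X], ((aeval a q : S) : K) = aeval θ q := fun q => by
    rw [← Subalgebra.coe_val, ← aeval_algHom_apply]
    rfl
  have haf : aeval a f = 0 := Subtype.ext (by rw [hcoe]; exact aeval_root_eq_zero_of_map f)
  have hsurj : Function.Surjective (aeval a : ℤ[X] →ₐ[ℤ] S) := by
    rintro ⟨x, hx⟩
    have hx' : x ∈ Algebra.adjoin ℤ {θ} := hx
    rw [Algebra.adjoin_singleton_eq_range_aeval] at hx'
    obtain ⟨q, rfl⟩ := hx'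
    exact ⟨q, Subtype.ext (hcoe q)⟩
  have hded : IsDedekindDomain S :=
    isDedekindDomain_of_surjective_polynomial (aeval a : ℤ[X] →ₐ[ℤ] S).toRingHom hsurj f hf haf
      (h S a haf)
  have hfrac : IsFractionRing S K := by
    refine IsFractionRing.of_field S K fun z => ?_
    obtain ⟨N, q, hN, hq⟩ := exists_smul_eq_aeval_root f z
    refine ⟨aeval a q, (N : S), ?_⟩
    have hN' : (N : K) ≠ 0 := by
      have : CharZero K := charZero_of_injective_algebraMap (algebraMap ℚ K).injective
      exact_mod_cast hN
    have h1 : algebraMap S K (aeval a q) = aeval θ q := hcoe q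
    rw [h1, ← hq]
    have h2 : algebraMap S K (N : S) = N := by simp
    rw [h2, mul_div_cancel_left₀ _ hN']
  apply le_antisymm
  · intro x hx
    have hxS : IsIntegral S x := IsIntegral.tower_top hx
    obtain ⟨y, rfl⟩ := IsIntegrallyClosed.isIntegral_iff.mp hxS
    exact y.2
  · rw [Algebra.adjoin_le_iff, Set.singleton_subset_iff]
    exact ⟨f, hf, aeval_root_eq_zero_of_map f⟩

/-- If `P ^ 2` lies in `(f, p ^ 2)` for some monic `P` of degree less than that of `f`, then
`P(θ) / p` is integral and `f` is not monogenic. -/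
theorem not_isMonogenicPolynomial_of_sq {f P S T : ℤ[X]} {p : ℤ} (hP : P.Monic)
    (hdeg : P.natDegree < f.natDegree) (hp : ¬ IsUnit p) (hp0 : p ≠ 0)
    (hsq : P ^ 2 = f * S + C (p ^ 2) * T) : ¬ IsMonogenicPolynomial f := by
  rintro ⟨hf, hirr, heq⟩
  have : Fact (Irreducible (f.map (Int.castRingHom ℚ))) := ⟨hirr⟩
  set K := AdjoinRoot (f.map (Int.castRingHom ℚ))
  set θ : K := AdjoinRoot.root (f.map (Int.castRingHom ℚ))
  have : CharZero K := charZero_of_injective_algebraMap (algebraMap ℚ K).injective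
  have hpK : (p : K) ≠ 0 := by exact_mod_cast hp0
  have hθint : IsIntegral ℤ θ := ⟨f, hf, aeval_root_eq_zero_of_map f⟩
  set β : K := aeval θ P / p
  have hβ : β ^ 2 = aeval θ T := by
    have h1 := congrArg (aeval θ) hsq
    rw [map_add, map_mul, map_mul, aeval_root_eq_zero_of_map, zero_mul, zero_add, map_pow] at h1
    rw [div_pow, h1, aeval_C, eq_intCast, Int.cast_pow]
    exact mul_div_cancel_left₀ _ (pow_ne_zero 2 hpK)
  have hTint : ∀ q : ℤ[X], IsIntegral ℤ (aeval θ q) := fun q =>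
    (aeval_mem_adjoin_singleton ℤ θ |> (Algebra.adjoin_le_iff.mpr
      (Set.singleton_subset_iff.mpr hθint) : Algebra.adjoin ℤ {θ} ≤ integralClosure ℤ K))
  have hβint : β ∈ integralClosure ℤ K :=
    IsIntegral.of_pow (n := 2) (by norm_num) (by rw [hβ]; exact hTint T)
  rw [heq, Algebra.adjoin_singleton_eq_range_aeval] at hβint
  obtain ⟨q, hq⟩ := hβint
  have hq : aeval θ q = β := hq
  -- If P(θ)/p = q(θ), then p(q mod f) - P is a multiple of f of smaller degree, hence zero.
  -- Comparing with the leading coefficient 1 of P makes p a unit.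
  have hdvd : f.map (Int.castRingHom ℚ) ∣ (C p * (q %ₘ f) - P).map (Int.castRingHom ℚ) := by
    rw [← AdjoinRoot.mk_eq_zero, ← AdjoinRoot.aeval_eq]
    have : aeval θ ((C p * (q %ₘ f) - P).map (algebraMap ℤ ℚ)) = 0 := by
      rw [aeval_map_algebraMap, modByMonic_eq_sub_mul_div]
      simp only [map_sub, map_mul, hq, aeval_C, β]
      rw [aeval_root_eq_zero_of_map f]
      rw [zero_mul, sub_zero, eq_intCast, mul_div_cancel₀ _ hpK, sub_self]
    exact this
  have hlt : (C p * (q %ₘ f) - P).degree < f.degree := by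
    refine (degree_sub_le _ _).trans_lt (max_lt ?_ ?_)
    · rw [degree_C_mul hp0]
      exact degree_modByMonic_lt _ hf
    · exact degree_lt_degree hdeg
  have hzero : C p * (q %ₘ f) - P = 0 := by
    have hinj : Function.Injective (Int.castRingHom ℚ) := RingHom.injective_int _
    refine (Polynomial.map_eq_zero_iff hinj).mp (eq_zero_of_dvd_of_degree_lt hdvd ?_)
    rwa [degree_map_eq_of_injective hinj, degree_map_eq_of_injective hinj]
  have hco := congrArg (fun r => coeff r P.natDegree) hzero
  simp only [coeff_sub, coeff_C_mul, coeff_zero, hP.coeff_natDegree, sub_eq_zero] at hco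
  exact hp (IsUnit.of_mul_eq_one _ hco)

/-! ### Local analysis of the trinomial at a prime -/

theorem intCast_mem_iff_dvd {R : Type*} [CommRing R] {P : Ideal R} (hP : P.IsPrime) {p : ℕ}
    (hp : p.Prime) (hpP : (p : R) ∈ P) (k : ℤ) : (k : R) ∈ P ↔ (p : ℤ) ∣ k := by
  constructor
  · intro hk
    by_contra hnd
    obtain ⟨x, y, hxy⟩ := ((Nat.prime_iff_prime_int.mp hp).coprime_iff_not_dvd).mpr hnd
    refine hP.ne_top ((Ideal.eq_top_iff_one P).mpr ?_)
    have h1 : (x : R) * p + y * k = 1 := by exact_mod_cast congrArg (Int.cast : ℤ → R) hxy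
    rw [← h1]
    exact P.add_mem (P.mul_mem_left _ hpP) (P.mul_mem_left _ hk)
  · rintro ⟨l, rfl⟩
    push_cast
    exact P.mul_mem_right _ hpP

/-- The linear form `(-t) ^ t - (t - 1) ^ (t - 1) A`, which up to sign is the part of the
discriminant of `x ^ (t m) + A x ^ m + A` coprime to `m A`. -/
def discrForm (t : ℕ) (A : ℤ) : ℤ := (-(t : ℤ)) ^ t - ((t : ℤ) - 1) ^ (t - 1) * A

theorem aeval_trinomial {R : Type*} [CommRing R] (n m : ℕ) (A : ℤ) (a : R) :
    aeval a (trinomial n m A) = a ^ n + A * a ^ m + A := by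
  simp [_root_.trinomial]

theorem mul_aeval_derivative_trinomial {R : Type*} [CommRing R] {n m : ℕ} (hn : n ≠ 0)
    (hm : m ≠ 0) (A : ℤ) (a : R) :
    a * aeval a (derivative (trinomial n m A)) = n * a ^ n + A * (m * a ^ m) := by
  obtain ⟨n, rfl⟩ := Nat.exists_eq_succ_of_ne_zero hn
  obtain ⟨m, rfl⟩ := Nat.exists_eq_succ_of_ne_zero hm
  simp [_root_.trinomial]
  ring

section Local

variable {R : Type*} [CommRing R] {P : Ideal R} {p : ℕ} {a : R} {A : ℤ} {m t : ℕ}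

/-- Eisenstein argument: p | A forces a ∈ P, so A = -(a^n + A a^m) lies in P², and A/p is prime to
p. -/
theorem exists_mul_prime_mem_sq_of_dvd (hP : P.IsPrime) (hp : p.Prime) (hpP : (p : R) ∈ P)
    {n : ℕ} (hn : 2 ≤ n) (hm : m ≠ 0) (ha : a ^ n + A * a ^ m + A = 0) (hpA : (p : ℤ) ∣ A)
    (hA : ¬ (p : ℤ) ^ 2 ∣ A) : ∃ s, s ∉ P ∧ s * (p : R) ∈ P ^ 2 := by
  have hAP := (intCast_mem_iff_dvd hP hp hpP A).mpr hpA
  obtain ⟨F, rfl⟩ := hpA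
  have hF : ¬ (p : ℤ) ∣ F := fun h => hA (by rw [pow_two]; exact mul_dvd_mul_left _ h)
  have haP : a ∈ P := by
    refine hP.mem_of_pow_mem n ?_
    have : a ^ n = -(((p * F : ℤ) : R) * (a ^ m + 1)) := by linear_combination ha
    rw [this]
    exact P.neg_mem (P.mul_mem_right _ hAP)
  refine ⟨F, fun h => hF ((intCast_mem_iff_dvd hP hp hpP F).mp h), ?_⟩
  have h1 : (F : R) * p = -(a ^ n + ((p * F : ℤ) : R) * a ^ m) := by
    push_cast at ha ⊢
    linear_combination ha
  rw [h1]
  refine neg_mem (add_mem (Ideal.pow_le_pow_right hn (Ideal.pow_mem_pow haP n)) ?_)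
  rw [pow_two]
  exact Ideal.mul_mem_mul hAP (P.pow_mem_of_mem haP m (Nat.pos_of_ne_zero hm))

/-- A root of `y ^ t + A y + A` modulo `p ^ 2` up to the value of `discrForm`, together with the
relations that make it a double root modulo `p`. -/
theorem exists_double_root {q : ℤ} (ht : 2 ≤ t) (hq : IsCoprime ((t : ℤ) - 1) q) (A : ℤ) :
    ∃ z : ℤ, q ∣ ((t : ℤ) - 1) * z + t ∧
      q ∣ ((t : ℤ) - 1) ^ t * (z ^ t + A * z + A) - discrForm t A ∧
      q ∣ z * (t * z ^ (t - 1) + A) - t * (z ^ t + A * z + A) := by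
  obtain ⟨x, y, hxy⟩ := hq
  obtain ⟨s, rfl⟩ : ∃ s, t = s + 1 := ⟨t - 1, by omega⟩
  -- Since x inverts t - 1 modulo q, z = -xt represents -t/(t-1). This is the candidate double root
  -- because y h'(y) - t h(y) = -A((t-1)y + t).
  have hz : q ∣ (((s + 1 : ℕ) : ℤ) - 1) * (-x * (s + 1 : ℕ)) + (s + 1 : ℕ) :=
    ⟨y * (s + 1 : ℕ), by linear_combination -((s + 1 : ℕ) : ℤ) * hxy⟩
  set z : ℤ := -x * (s + 1 : ℕ)
  refine ⟨z, hz, ?_, ?_⟩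
  · have h1 : q ∣ ((((s + 1 : ℕ) : ℤ) - 1) * z) ^ (s + 1) - (-((s + 1 : ℕ) : ℤ)) ^ (s + 1) := by
      refine dvd_trans ?_ (sub_dvd_pow_sub_pow _ _ _)
      rw [sub_neg_eq_add]
      exact hz
    have h2 : (((s + 1 : ℕ) : ℤ) - 1) ^ (s + 1) * (z ^ (s + 1) + A * z + A)
          - discrForm (s + 1) A =
        (((((s + 1 : ℕ) : ℤ) - 1) * z) ^ (s + 1) - (-((s + 1 : ℕ) : ℤ)) ^ (s + 1)) +
        ((((s + 1 : ℕ) : ℤ) - 1) * z + (s + 1 : ℕ)) * ((((s + 1 : ℕ) : ℤ) - 1) ^ s * A) := by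
      simp only [discrForm, Nat.add_sub_cancel]
      push_cast
      ring
    rw [h2]
    exact dvd_add h1 (dvd_mul_of_dvd_left hz _)
  · have h3 : z * ((s + 1 : ℕ) * z ^ (s + 1 - 1) + A) - (s + 1 : ℕ) * (z ^ (s + 1) + A * z + A) =
        ((((s + 1 : ℕ) : ℤ) - 1) * z + (s + 1 : ℕ)) * (-A) := by
      simp only [Nat.add_sub_cancel]
      push_cast
      ring
    rw [h3]
    exact dvd_mul_of_dvd_left hz _

/-- With z = a^m, the relations h(z) = 0 and f'(a) ∈ P give (t-1)z + t ∈ P. This excludes p | t(t-1)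
and puts z in the class of the integer x = -t/(t-1) modulo P. Since p² ∤ B, p divides h(x) exactly
once, so it is enough that h(x) ∈ P². -/
theorem exists_mul_prime_mem_sq_of_not_dvd (hP : P.IsPrime) (hp : p.Prime) (hpP : (p : R) ∈ P)
    (ht : 2 ≤ t) (hm : m ≠ 0) (ha : a ^ (m * t) + A * a ^ m + A = 0) (hpA : ¬ (p : ℤ) ∣ A)
    (hpm : ¬ p ∣ m) (hB : ¬ p ∣ t * (t - 1) → ¬ (p : ℤ) ^ 2 ∣ discrForm t A)
    (hd : aeval a (derivative (trinomial (m * t) m A)) ∈ P) :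
    ∃ s, s ∉ P ∧ s * (p : R) ∈ P ^ 2 := by
  have hmem := intCast_mem_iff_dvd hP hp hpP
  have hpZ := Nat.prime_iff_prime_int.mp hp
  have hAP : (A : R) ∉ P := fun h => hpA ((hmem A).mp h)
  rw [pow_mul] at ha
  have h1 : (m : R) * ((t : R) * (a ^ m) ^ t + A * a ^ m) ∈ P := by
    have h := mul_aeval_derivative_trinomial (mul_ne_zero hm (by omega : t ≠ 0)) hm A a
    have h' : (m : R) * ((t : R) * (a ^ m) ^ t + A * a ^ m) =
        a * aeval a (derivative (trinomial (m * t) m A)) := by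
      rw [h]; push_cast; ring
    rw [h']
    exact P.mul_mem_left _ hd
  set z := a ^ m
  have h2 : (t : R) * z ^ t + A * z ∈ P := by
    refine (hP.mem_or_mem h1).resolve_left fun h => hpm ?_
    have := (hmem m).mp (by exact_mod_cast h)
    exact_mod_cast this
  have hzP : z ∉ P := fun h => hAP (by
    have h' : (A : R) = -(z ^ t + A * z) := by linear_combination ha
    rw [h']
    exact P.neg_mem (P.add_mem (P.pow_mem_of_mem h t (by omega)) (P.mul_mem_left _ h)))
  have h3 : ((t : R) - 1) * z + t ∈ P := by
    refine (hP.mem_or_mem (x := (A : R)) ?_).resolve_left hAP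
    have h' : (A : R) * (((t : R) - 1) * z + t) = -((t : R) * z ^ t + A * z) := by
      linear_combination (t : R) * ha
    rw [h']
    exact P.neg_mem h2
  have hu : ¬ (p : ℤ) ∣ (t : ℤ) - 1 := by
    intro h
    have hu' := (hmem _).mpr h
    have ht' : ((t : ℤ) : R) ∈ P := by
      have h' : ((t : ℤ) : R) = ((t : R) - 1) * z + t - (((t : ℤ) - 1 : ℤ) : R) * z := by
        push_cast; ring
      rw [h']
      exact P.sub_mem h3 (P.mul_mem_right _ hu')
    have := dvd_sub ((hmem _).mp ht') h
    rw [sub_sub_cancel] at this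
    exact hpZ.not_dvd_one this
  have ht' : ¬ (p : ℤ) ∣ t := by
    intro h
    have hu' := (hmem _).mpr h
    have h4 : (((t : ℤ) - 1 : ℤ) : R) * z ∈ P := by
      have h' : (((t : ℤ) - 1 : ℤ) : R) * z = ((t : R) - 1) * z + t - ((t : ℤ) : R) := by
        push_cast; ring
      rw [h']
      exact P.sub_mem h3 hu'
    rcases hP.mem_or_mem h4 with h5 | h5
    · exact hu ((hmem _).mp h5)
    · exact hzP h5
  have hB' : ¬ (p : ℤ) ^ 2 ∣ discrForm t A := by
    refine hB fun h => ?_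
    rcases hp.dvd_mul.mp h with h | h
    · exact ht' (by exact_mod_cast h)
    · apply hu
      have := Int.natCast_dvd_natCast.mpr h
      rwa [Nat.cast_sub (by omega), Nat.cast_one] at this
  obtain ⟨x, hx1, hx2, hx3⟩ := exists_double_root (q := (p : ℤ) ^ 2) ht
    (((hpZ.coprime_iff_not_dvd).mpr hu).symm.pow_right) A
  have hpp : (p : ℤ) ∣ (p : ℤ) ^ 2 := dvd_pow_self _ two_ne_zero
  have hw : z - (x : R) ∈ P := by
    have h4 : (((t : ℤ) - 1 : ℤ) : R) * (z - x) ∈ P := by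
      have h' : (((t : ℤ) - 1 : ℤ) : R) * (z - x) =
          ((t : R) - 1) * z + t - ((((t : ℤ) - 1) * x + t : ℤ) : R) := by
        push_cast; ring
      rw [h']
      exact P.sub_mem h3 ((hmem _).mpr (hpp.trans hx1))
    exact (hP.mem_or_mem h4).resolve_left fun h => hu ((hmem _).mp h)
  -- Taylor expansion: 0 = h(x) + h'(x)(z - x) + k(z - x)², where both h'(x) and z - x will lie in
  -- P.
  obtain ⟨k, hk⟩ := binomExpansion (X ^ t + C (A : R) * X + C (A : R)) (x : R) (z - x)
  simp only [add_sub_cancel, eval_add, eval_pow, eval_X, eval_mul, eval_C, ha, derivative_add,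
    derivative_X_pow, derivative_mul, derivative_C, derivative_X, eval_natCast, zero_mul,
    zero_add, mul_one, add_zero, map_natCast] at hk
  set H : ℤ := x ^ t + A * x + A with hH
  set D : ℤ := t * x ^ (t - 1) + A with hD
  have hk' : (H : R) = -((D : R) * (z - x)) - k * (z - x) ^ 2 := by
    rw [hH, hD]
    push_cast
    linear_combination -hk
  have hHp2 : ¬ (p : ℤ) ^ 2 ∣ H := by
    intro h
    apply hB'
    have := dvd_sub (dvd_mul_of_dvd_right h (((t : ℤ) - 1) ^ t)) hx2
    rwa [sub_sub_cancel] at this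
  have hHP : (p : ℤ) ∣ H := by
    refine (hmem H).mp ?_
    rw [hk']
    exact P.sub_mem (P.neg_mem (P.mul_mem_left _ hw))
      (P.mul_mem_left _ (P.pow_mem_of_mem hw 2 two_pos))
  have hx0 : ¬ (p : ℤ) ∣ x := by
    intro h
    apply ht'
    have := dvd_sub (hpp.trans hx1) (dvd_mul_of_dvd_right h ((t : ℤ) - 1))
    rwa [add_sub_cancel_left] at this
  have hDP : (p : ℤ) ∣ D := by
    have := dvd_add (hpp.trans hx3) (dvd_mul_of_dvd_right hHP (t : ℤ))
    rw [sub_add_cancel] at this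
    exact (hpZ.dvd_or_dvd this).resolve_left hx0
  have hDmem := (hmem D).mpr hDP
  obtain ⟨r, hr⟩ := hHP
  refine ⟨r, fun h => hHp2 ?_, ?_⟩
  · rw [hr, pow_two]
    exact mul_dvd_mul_left _ ((hmem r).mp h)
  · have h' : (r : R) * p = H := by rw [hr]; push_cast; ring
    rw [h', hk', pow_two P, pow_two (z - _)]
    exact sub_mem (neg_mem (Ideal.mul_mem_mul hDmem hw))
      (Ideal.mul_mem_left _ _ (Ideal.mul_mem_mul hw hw))

/-- For `p ≤ 7`, the polynomial `((v + 1) ^ p - v ^ p - 1) / p` only has the irreducible factors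
`v`, `v + 1` and, for odd `p`, `v ^ 2 + v + 1`. -/
theorem exists_add_one_pow_eq (hp : p = 2 ∨ p = 3 ∨ p = 5 ∨ p = 7) (v : R) :
    ∃ i j k : ℕ, (p = 2 → k = 0) ∧
      (v + 1) ^ p = v ^ p + 1 + p * (v ^ i * (v + 1) ^ j * (v ^ 2 + v + 1) ^ k) := by
  rcases hp with rfl | rfl | rfl | rfl
  · exact ⟨1, 0, 0, fun _ => rfl, by push_cast; ring⟩
  · exact ⟨1, 1, 0, fun _ => rfl, by push_cast; ring⟩
  · exact ⟨1, 1, 1, fun h => by omega, by push_cast; ring⟩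
  · exact ⟨1, 1, 2, fun h => by omega, by push_cast; ring⟩

/-- Put H = v^t - v - 1 and Q = ((v+1)^p - v^p - 1)/p. Expanding (v + 1 + H)^p shows p | H^p, so H ∈
P, and then pQ is a sum of multiples of p², pH and H^p, all in P². Modulo P one has v^t = v + 1,
which keeps v and v + 1 out of P. A zero of v² + v + 1 would force 2 ∈ P, while that factor is
absent for p = 2. -/
theorem exists_mul_prime_mem_sq_of_dvd_exponent (hP : P.IsPrime) (hp : p.Prime)
    (hpP : (p : R) ∈ P) (hp7 : p = 2 ∨ p = 3 ∨ p = 5 ∨ p = 7) (ht : t ≠ 0) {v : R}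
    (hv : (v ^ t) ^ p + A * v ^ p + A = 0) (hA : A ≡ -1 [ZMOD (p : ℤ) ^ 2]) :
    ∃ s, s ∉ P ∧ s * (p : R) ∈ P ^ 2 := by
  obtain ⟨c, hc⟩ := hA.dvd
  have hAc : (A : R) = -1 - (p : R) ^ 2 * c := by
    have h : A = -1 - (p : ℤ) ^ 2 * c := by linear_combination -hc
    rw [h]; push_cast; ring
  rw [hAc] at hv
  set H := v ^ t - v - 1 with hH
  obtain ⟨r, hr⟩ := exists_add_pow_prime_eq hp (v + 1) H
  obtain ⟨i, j, k, hk, hijk⟩ := exists_add_one_pow_eq (R := R) hp7 v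
  set Q := v ^ i * (v + 1) ^ j * (v ^ 2 + v + 1) ^ k
  have hVH : v + 1 + H = v ^ t := by rw [hH]; ring
  rw [hVH] at hr
  have hmain : Q * p = (p : R) * p * (c * (v ^ p + 1)) - p * H * ((v + 1) * r) - H ^ p := by
    linear_combination hv - hr - hijk
  have hHP : H ∈ P := by
    refine hP.mem_of_pow_mem p ?_
    have h : H ^ p = p * (p * (c * (v ^ p + 1)) - H * ((v + 1) * r) - Q) := by
      linear_combination hmain
    rw [h]
    exact P.mul_mem_right _ hpP
  have hvP : v ∉ P := by
    intro h
    refine hP.ne_top ((Ideal.eq_top_iff_one P).mpr ?_)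
    have h1 : (1 : R) = v * v ^ (t - 1) - v - H := by
      rw [← pow_succ', Nat.sub_add_cancel (Nat.pos_of_ne_zero ht), hH]; ring
    rw [h1]
    exact P.sub_mem (P.sub_mem (P.mul_mem_right _ h) h) hHP
  have hv1P : v + 1 ∉ P := by
    intro h
    refine hvP (hP.mem_of_pow_mem t ?_)
    rw [← hVH]
    exact P.add_mem h hHP
  refine ⟨Q, ?_, ?_⟩
  · intro hQ
    rcases hP.mem_or_mem hQ with hQ | hQ
    · rcases hP.mem_or_mem hQ with hQ | hQ
      · exact hvP (hP.mem_of_pow_mem i hQ)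
      · exact hv1P (hP.mem_of_pow_mem j hQ)
    · have hω := hP.mem_of_pow_mem k hQ
      have hp2 : p ≠ 2 := by
        intro h2
        rw [hk h2, pow_zero] at hQ
        exact hP.ne_top ((Ideal.eq_top_iff_one P).mpr hQ)
      -- modulo `P`, `v` is a primitive cube root of unity and `v ^ t = - v ^ 2`
      have hcube : v ^ 3 - 1 ∈ P := by
        have h : v ^ 3 - 1 = (v - 1) * (v ^ 2 + v + 1) := by ring
        rw [h]
        exact P.mul_mem_left _ hω
      have h1 : (v ^ t) ^ 3 - 1 ∈ P := by
        rw [← pow_mul, mul_comm t 3, pow_mul]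
        refine P.mem_of_dvd ?_ hcube
        simpa using sub_dvd_pow_sub_pow (v ^ 3) 1 t
      have h2 : v ^ t + v ^ 2 ∈ P := by
        have h : v ^ t + v ^ 2 = H + (v ^ 2 + v + 1) := by rw [hH]; ring
        rw [h]
        exact P.add_mem hHP hω
      have h3 : ((2 : ℤ) : R) ∈ P := by
        have h : ((2 : ℤ) : R) = (v ^ t + v ^ 2) * ((v ^ t) ^ 2 - v ^ t * v ^ 2 + v ^ 4)
            - ((v ^ t) ^ 3 - 1) - (v ^ 3 - 1) * (v ^ 3 + 1) := by
          push_cast; ring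
        rw [h]
        exact P.sub_mem (P.sub_mem (P.mul_mem_right _ h2) h1) (P.mul_mem_right _ hcube)
      have h4 : p ∣ 2 := by exact_mod_cast (intCast_mem_iff_dvd hP hp hpP 2).mp h3
      exact hp2 ((Nat.prime_dvd_prime_iff_eq hp Nat.prime_two).mp h4)
  · rw [hmain, pow_two P]
    refine sub_mem (sub_mem (Ideal.mul_mem_right _ _ (Ideal.mul_mem_mul hpP hpP))
      (Ideal.mul_mem_right _ _ (Ideal.mul_mem_mul hpP hHP))) ?_
    rw [← pow_two]
    exact Ideal.pow_le_pow_right hp.two_le (Ideal.pow_mem_pow hHP p)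

end Local

/-! ### Irreducibility, obstructions to monogenicity, and the discriminant -/

section Trinomial

variable {n m t : ℕ} {A : ℤ}

theorem degree_C_mul_X_pow_add_C_lt (hlt : m < n) (a b : ℤ) :
    (C a * X ^ m + C b).degree < (n : WithBot ℕ) := by
  refine (degree_add_le _ _).trans_lt (max_lt ?_ ?_)
  · exact (degree_C_mul_X_pow_le m a).trans_lt (by exact_mod_cast hlt)
  · exact degree_C_le.trans_lt (by exact_mod_cast (Nat.zero_le m).trans_lt hlt)

theorem trinomial_eq (n m : ℕ) (A : ℤ) : trinomial n m A = X ^ n + (C A * X ^ m + C A) := by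
  simp only [_root_.trinomial, add_assoc]

theorem trinomial_monic (hlt : m < n) : (trinomial n m A).Monic := by
  rw [trinomial_eq]
  exact monic_X_pow_add (degree_C_mul_X_pow_add_C_lt hlt A A)

theorem trinomial_natDegree (hlt : m < n) : (trinomial n m A).natDegree = n := by
  rw [trinomial_eq]
  have h := degree_C_mul_X_pow_add_C_lt hlt A A
  refine natDegree_eq_of_degree_eq_some ?_
  rw [degree_add_eq_left_of_degree_lt (by rwa [degree_X_pow]), degree_X_pow]

theorem trinomial_irreducible_map {p : ℕ} (hp : p.Prime) (hm : m ≠ 0) (hlt : m < n)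
    (hpA : (p : ℤ) ∣ A) (hA : ¬ (p : ℤ) ^ 2 ∣ A) :
    Irreducible ((trinomial n m A).map (Int.castRingHom ℚ)) := by
  have hmonic := trinomial_monic (A := A) hlt
  have hpZ := Nat.prime_iff_prime_int.mp hp
  have hdeg : (trinomial n m A).degree = n := by
    rw [degree_eq_natDegree hmonic.ne_zero, trinomial_natDegree hlt]
  have h0 : n ≠ 0 := by omega
  refine (hmonic.irreducible_iff_irreducible_map_fraction_map (K := ℚ)).mp ?_
  refine irreducible_of_eisenstein_criterion (P := Ideal.span {(p : ℤ)})
    ((Ideal.span_singleton_prime hpZ.ne_zero).mpr hpZ) ?_ ?_ ?_ ?_ hmonic.isPrimitive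
  · rw [hmonic.leadingCoeff, Ideal.mem_span_singleton]
    exact hpZ.not_dvd_one
  · intro k hk
    rw [hdeg] at hk
    have hk' : k ≠ n := by rintro rfl; exact lt_irrefl _ hk
    rw [Ideal.mem_span_singleton]
    simp only [_root_.trinomial, coeff_add, coeff_X_pow, if_neg hk', coeff_C_mul, coeff_C]
    split_ifs <;> simp [hpA, dvd_add]
  · rw [hdeg]
    exact_mod_cast Nat.pos_of_ne_zero h0
  · rw [Ideal.span_singleton_pow, Ideal.mem_span_singleton]
    simpa [_root_.trinomial, coeff_X_pow, h0.symm, hm.symm] using hA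

/-- The offending element is θ^(n-1)/p: X^(2n-2) = X^(n-2) · X^n, and X^n = f - A(X^m + 1). -/
theorem not_isMonogenicPolynomial_of_sq_dvd {p : ℤ} (hn : 2 ≤ n) (hlt : m < n) (hp : Prime p)
    (hA : p ^ 2 ∣ A) : ¬ IsMonogenicPolynomial (trinomial n m A) := by
  obtain ⟨c, rfl⟩ := hA
  refine not_isMonogenicPolynomial_of_sq (P := X ^ (n - 1)) (S := X ^ (n - 2))
    (T := -(C c * (X ^ m + 1) * X ^ (n - 2))) (monic_X_pow _) ?_ hp.not_isUnit hp.ne_zero ?_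
  · rw [natDegree_X_pow, trinomial_natDegree hlt]
    omega
  · obtain ⟨k, rfl⟩ := Nat.exists_eq_add_of_le hn
    have h1 : 2 + k - 1 = k + 1 := by omega
    have h2 : 2 + k - 2 = k := by omega
    rw [h1, h2, _root_.trinomial, C_mul]
    ring

/-- Here h ≡ (y - z)² q mod p², so ((y - z) q)² ≡ h q. Substituting y = x^m gives the monic
polynomial whose value at θ is divisible by p among the integers. -/
theorem not_isMonogenicPolynomial_of_sq_dvd_discrForm {p : ℤ} (ht : 2 ≤ t) (hm : m ≠ 0)
    (hp : Prime p) (hpt : ¬ p ∣ t) (hpu : ¬ p ∣ (t : ℤ) - 1) (hB : p ^ 2 ∣ discrForm t A) :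
    ¬ IsMonogenicPolynomial (trinomial (m * t) m A) := by
  obtain ⟨z, hz1, hz2, hz3⟩ := exists_double_root (q := p ^ 2) ht
    (((hp.coprime_iff_not_dvd).mpr hpu).symm.pow_right) A
  have hz0 : ¬ p ∣ z := by
    intro h
    apply hpt
    have := dvd_sub ((dvd_pow_self p two_ne_zero).trans hz1)
      (dvd_mul_of_dvd_right h ((t : ℤ) - 1))
    rwa [add_sub_cancel_left] at this
  have hH : p ^ 2 ∣ z ^ t + A * z + A := by
    have h1 := dvd_add hz2 hB
    rw [sub_add_cancel] at h1
    exact (IsCoprime.pow ((hp.coprime_iff_not_dvd).mpr hpu)).dvd_of_dvd_mul_left h1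
  have hD : p ^ 2 ∣ t * z ^ (t - 1) + A := by
    have h1 := dvd_add hz3 (dvd_mul_of_dvd_right hH t)
    rw [sub_add_cancel] at h1
    exact (((hp.coprime_iff_not_dvd).mpr hz0).pow_left).dvd_of_dvd_mul_left h1
  set h : ℤ[X] := X ^ t + C A * X + C A with hh
  have hhdeg : h.natDegree = t := by
    have := trinomial_natDegree (A := A) (n := t) (m := 1) (by omega)
    rwa [_root_.trinomial, pow_one] at this
  have hhm : h.Monic := by
    have := trinomial_monic (A := A) (n := t) (m := 1) (by omega)
    rwa [_root_.trinomial, pow_one] at this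
  set D : ℤ[X] := (X - C z) ^ 2 with hDdef
  have hDm : D.Monic := (monic_X_sub_C z).pow 2
  have hDdeg : D.natDegree = 2 := by rw [hDdef, natDegree_pow, natDegree_X_sub_C]
  set q := h /ₘ D with hq
  have hdiv : h %ₘ D + D * q = h := modByMonic_add_div h D
  have hqdeg : q.natDegree = t - 2 := by rw [natDegree_divByMonic _ hDm, hhdeg, hDdeg]
  have hqm : q.Monic := by
    rw [Monic, leadingCoeff_divByMonic_of_monic hDm ?_, hhm.leadingCoeff]
    rw [degree_eq_natDegree hDm.ne_zero, degree_eq_natDegree hhm.ne_zero, hDdeg, hhdeg]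
    exact_mod_cast ht
  obtain ⟨b, c, hbc⟩ : ∃ b c : ℤ, h %ₘ D = C b * X + C c := by
    have : (h %ₘ D).natDegree ≤ 1 := by
      have := natDegree_modByMonic_lt h hDm (by
        intro h1
        rw [h1, natDegree_one] at hDdeg
        omega)
      omega
    exact ⟨_, _, eq_X_add_C_of_natDegree_le_one this⟩
  rw [hbc] at hdiv
  -- The remainder bX + c of h by (X - z)² satisfies b = h'(z) and bz + c = h(z).
  have hb : p ^ 2 ∣ b := by
    have h1 := congrArg (fun r => eval z (derivative r)) hdiv
    simp [hh, hDdef, derivative_pow] at h1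
    rw [h1]
    exact hD
  have hc : p ^ 2 ∣ b * z + c := by
    have h1 := congrArg (eval z) hdiv
    simp [hh, hDdef] at h1
    rw [h1]
    exact hH
  have hc' : p ^ 2 ∣ c := (dvd_add_right (dvd_mul_of_dvd_left hb z)).mp hc
  obtain ⟨b, rfl⟩ := hb
  obtain ⟨c, rfl⟩ := hc'
  have hcomp : h.comp (X ^ m) = trinomial (m * t) m A := by
    rw [hh, _root_.trinomial, pow_mul]
    simp
  have hXm : (X ^ m : ℤ[X]).natDegree = m := natDegree_X_pow m
  refine not_isMonogenicPolynomial_of_sq (P := ((X - C z) * q).comp (X ^ m))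
    (S := q.comp (X ^ m)) (T := -((C b * X + C c) * q).comp (X ^ m)) ?_ ?_
    hp.not_isUnit hp.ne_zero ?_
  · exact ((monic_X_sub_C z).mul hqm).comp (monic_X_pow m) (by rwa [hXm])
  · rw [natDegree_comp, hXm, (monic_X_sub_C z).natDegree_mul hqm, natDegree_X_sub_C, hqdeg,
      trinomial_natDegree]
    · rw [mul_comm m t]
      exact Nat.mul_lt_mul_of_pos_right (by omega) (Nat.pos_of_ne_zero hm)
    · exact lt_mul_of_one_lt_right (Nat.pos_of_ne_zero hm) (by omega)
  · have h1 : ((X - C z) * q) ^ 2 = h * q + C (p ^ 2) * -((C b * X + C c) * q) := by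
      rw [← hdiv, hDdef, C_mul, C_mul]
      ring
    rw [← hcomp, ← pow_comp, h1]
    simp only [add_comp, mul_comp, neg_comp, C_comp]

/-- Modulo f, X f' is A times another polynomial, so Res(f, X f') is divisible by A^n, while Res(f,
X) = ±A. Hence A^(n-1) divides the discriminant, and n - 1 ≥ 2. -/
theorem not_squarefree_discr_trinomial (hn : 3 ≤ n) (hm : m ≠ 0) (hlt : m < n) (hA : 1 < A) :
    ¬ Squarefree (trinomial n m A).discr := by
  set f := trinomial n m A with hf
  have hdeg : f.natDegree = n := trinomial_natDegree hlt
  have hmonic : f.Monic := trinomial_monic hlt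
  have hder := resultant_deriv (f := f) (by
    rw [degree_eq_natDegree hmonic.ne_zero, hdeg]
    exact_mod_cast (by omega : 0 < n))
  rw [hdeg, hmonic.leadingCoeff, mul_one] at hder
  have hddeg : (derivative f).natDegree = n - 1 := by
    rw [natDegree_derivative, hdeg]
  have hmul := resultant_mul_right f X (derivative f) n hdeg.le
  rw [natDegree_X, hddeg, hder, Nat.add_sub_cancel' (by omega : 1 ≤ n)] at hmul
  have hX : f.resultant X n 1 = (-1) ^ n * A := by
    have h1 := resultant_X_pow_right f n 1 hdeg.le
    have h0 : f.coeff 0 = A := by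
      simp [hf, _root_.trinomial, coeff_X_pow, hm.symm]
      omega
    rwa [h0, pow_one, mul_one, pow_one] at h1
  have hXd : X * derivative f =
      C A * (C ((m : ℤ) - n) * X ^ m - C (n : ℤ)) + f * C (n : ℤ) := by
    obtain ⟨k, rfl⟩ := Nat.exists_eq_succ_of_ne_zero hm
    obtain ⟨l, rfl⟩ : ∃ l, n = l + 1 := ⟨n - 1, by omega⟩
    simp [hf, _root_.trinomial]
    ring
  -- The second argument keeps formal degree n after reduction modulo f. The scalar A comes out to
  -- the power n because f has degree n.
  rw [hXd, resultant_add_mul_right _ _ _ _ _ (by rw [natDegree_C, zero_add]) hdeg.le,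
    resultant_C_mul_right, hX] at hmul
  obtain ⟨k, rfl⟩ : ∃ k, n = k + 3 := ⟨n - 3, by omega⟩
  have hA0 : A ≠ 0 := by omega
  have hdvd : A * A ∣ (-1) ^ (k + 3) * ((-1) ^ ((k + 3) * (k + 3 - 1) / 2) * f.discr) := by
    refine (mul_dvd_mul_iff_left hA0).mp ?_
    have h1 : A * ((-1) ^ (k + 3) * ((-1) ^ ((k + 3) * (k + 3 - 1) / 2) * f.discr)) =
        A * (A * A) * (A ^ k * f.resultant (C (((m : ℕ) : ℤ) - (k + 3 : ℕ)) * X ^ m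
          - C ((k + 3 : ℕ) : ℤ)) (k + 3) (k + 3)) := by
      linear_combination -hmul
    rw [h1]
    exact dvd_mul_right _ _
  have hu : ∀ j : ℕ, IsUnit ((-1 : ℤ) ^ j) := fun j => (isUnit_one.neg).pow j
  rw [(hu _).dvd_mul_left, (hu _).dvd_mul_left] at hdvd
  intro hsq
  have := Int.isUnit_iff.mp (hsq A hdvd)
  omega

end Trinomial

/-! ### The arithmetic criterion -/

theorem isMonogenicPolynomial_trinomial_iff {m t A : ℕ} (hm : m ≠ 0) (ht : 2 ≤ t) (hA : 1 < A)
    (h210 : UniqueFactorizationMonoid.radical m ∣ 210)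
    (hmod : (A : ℤ) ≡ -1 [ZMOD ((UniqueFactorizationMonoid.radical m : ℕ) : ℤ) ^ 2]) :
    IsMonogenicPolynomial (trinomial (m * t) m A) ↔
      Squarefree A ∧ ∀ p : ℕ, p.Prime → ¬ p ∣ t * (t - 1) * UniqueFactorizationMonoid.radical m →
        ¬ (p : ℤ) ^ 2 ∣ discrForm t A := by
  have hlt : m < m * t := lt_mul_of_one_lt_right (Nat.pos_of_ne_zero hm) (by omega)
  have hrad : ∀ p : ℕ, p.Prime → (p ∣ UniqueFactorizationMonoid.radical m ↔ p ∣ m) := fun p hp =>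
    UniqueFactorizationMonoid.dvd_radical_iff_of_irreducible hp.prime.irreducible hm
  constructor
  · refine fun h => ⟨?_, fun p hp hpd hB => ?_⟩
    · rw [Nat.squarefree_iff_prime_squarefree]
      intro p hp hpA
      refine not_isMonogenicPolynomial_of_sq_dvd (by omega) hlt (Nat.prime_iff_prime_int.mp hp)
        ?_ h
      rw [pow_two]
      exact_mod_cast hpA
    · rw [hp.dvd_mul, hp.dvd_mul] at hpd
      push Not at hpd
      refine not_isMonogenicPolynomial_of_sq_dvd_discrForm ht hm (Nat.prime_iff_prime_int.mp hp)
        (by exact_mod_cast hpd.1.1) ?_ hB h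
      intro h1
      apply hpd.1.2
      rw [← Int.natCast_dvd_natCast, Nat.cast_sub (by omega), Nat.cast_one]
      exact h1
  · rintro ⟨hsq, hB⟩
    have hsq' : ∀ p : ℕ, p.Prime → ¬ (p : ℤ) ^ 2 ∣ A := fun p hp h =>
      Nat.squarefree_iff_prime_squarefree.mp hsq p hp (by rw [← pow_two]; exact_mod_cast h)
    have hirr : Irreducible ((trinomial (m * t) m A).map (Int.castRingHom ℚ)) :=
      trinomial_irreducible_map (Nat.minFac_prime hA.ne') hm hlt
        (Int.natCast_dvd_natCast.mpr (Nat.minFac_dvd A)) (hsq' _ (Nat.minFac_prime hA.ne'))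
    refine isMonogenicPolynomial_of_local _ (trinomial_monic hlt) hirr
      fun R _ _ a ha P p hP hp hpP => ?_
    rw [aeval_trinomial] at ha
    by_cases hpA : (p : ℤ) ∣ A
    · exact Or.inr (exists_mul_prime_mem_sq_of_dvd hP hp hpP (by omega) hm ha hpA (hsq' p hp))
    by_cases hpm : p ∣ m
    · right
      have hpr := (hrad p hp).mpr hpm
      have hp7 : p = 2 ∨ p = 3 ∨ p = 5 ∨ p = 7 := by
        have h1 : p ∣ 2 * 3 * 5 * 7 := hpr.trans h210
        rw [hp.dvd_mul, hp.dvd_mul, hp.dvd_mul,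
          Nat.prime_dvd_prime_iff_eq hp Nat.prime_two, Nat.prime_dvd_prime_iff_eq hp Nat.prime_three,
          Nat.prime_dvd_prime_iff_eq hp Nat.prime_five,
          Nat.prime_dvd_prime_iff_eq hp (by norm_num)] at h1
        tauto
      obtain ⟨k, rfl⟩ := hpm
      -- With m = pk and v = a^k, f(a) is (v^t)^p + A v^p + A.
      refine exists_mul_prime_mem_sq_of_dvd_exponent (v := a ^ k) (A := A) (t := t) hP hp hpP hp7
        (by omega) ?_ (hmod.of_dvd (pow_dvd_pow_of_dvd (Int.natCast_dvd_natCast.mpr hpr) 2))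
      rw [← ha]
      ring
    · by_cases hd : aeval a (derivative (trinomial (m * t) m A)) ∈ P
      · refine Or.inr (exists_mul_prime_mem_sq_of_not_dvd hP hp hpP ht hm ha hpA hpm
          (fun h => hB p hp ?_) hd)
        rw [hp.dvd_mul]
        exact not_or.mpr ⟨h, fun h' => hpm ((hrad p hp).mp h')⟩
      · exact Or.inl hd

/-! ### Möbius detection, congruence counts and convergence of the density -/

section Sieve

open Finset ArithmeticFunction
open scoped ArithmeticFunction.Moebius Classical

/-- A finite set of positive integers closed under divisors and least common multiples is the set
of divisors of an integer. -/
theorem exists_eq_divisors (D : Finset ℕ) (h1 : 1 ∈ D) (h0 : 0 ∉ D)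
    (hdvd : ∀ e ∈ D, ∀ d, d ∣ e → d ∈ D) (hlcm : ∀ d ∈ D, ∀ e ∈ D, d.lcm e ∈ D) :
    ∃ L ∈ D, D = L.divisors := by
  obtain ⟨L, hL, hmax⟩ := D.exists_max_image id ⟨1, h1⟩
  have hL0 : L ≠ 0 := fun h => h0 (h ▸ hL)
  refine ⟨L, hL, ?_⟩
  ext e
  rw [Nat.mem_divisors]
  refine ⟨fun he => ⟨?_, hL0⟩, fun he => hdvd L hL e he.1⟩
  have hle : L.lcm e = L := le_antisymm (hmax _ (hlcm L hL e he))
    (Nat.le_of_dvd (Nat.pos_of_ne_zero fun h => h0 (h ▸ hlcm L hL e he)) (Nat.dvd_lcm_left L e))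
  exact hle ▸ Nat.dvd_lcm_right L e

theorem sum_divisors_moebius (L : ℕ) : ∑ d ∈ L.divisors, (μ d : ℝ) = if L = 1 then 1 else 0 := by
  have h := coe_mul_zeta_apply (f := (μ : ArithmeticFunction ℝ)) (x := L)
  rw [coe_moebius_mul_coe_zeta, one_apply] at h
  rw [h]
  rfl

/-- The e coprime to N with e² | b are closed under divisors and lcm, hence are the divisors of one
L, and the Möbius sum detects L = 1. The bound on |b| makes the cut at E lossless. -/
theorem sum_moebius_sq_dvd {b : ℤ} (hb : b ≠ 0) (N E : ℕ) (hE : b.natAbs ≤ E ^ 2) :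
    ∑ e ∈ Ioc 0 E, (if e.Coprime N ∧ (e : ℤ) ^ 2 ∣ b then (μ e : ℝ) else 0) =
      if ∀ p : ℕ, p.Prime → ¬ p ∣ N → ¬ (p : ℤ) ^ 2 ∣ b then 1 else 0 := by
  set b' := b.natAbs with hb'
  have hb0 : b' ≠ 0 := Int.natAbs_ne_zero.mpr hb
  have hdvd : ∀ e : ℕ, (e : ℤ) ^ 2 ∣ b ↔ e ^ 2 ∣ b' := fun e => by
    rw [hb', ← Int.natCast_dvd, Nat.cast_pow]
  simp only [hdvd]
  rw [← sum_filter]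
  set D := (Ioc 0 E).filter (fun e => e.Coprime N ∧ e ^ 2 ∣ b')
  have hmem : ∀ e, e ∈ D ↔ e.Coprime N ∧ e ^ 2 ∣ b' := by
    intro e
    simp only [D, mem_filter, mem_Ioc, and_iff_right_iff_imp]
    rintro ⟨-, he⟩
    refine ⟨Nat.pos_of_ne_zero ?_, ?_⟩
    · rintro rfl
      exact hb0 (by simpa using he)
    · exact (Nat.pow_le_pow_iff_left two_ne_zero).mp
        ((Nat.le_of_dvd (Nat.pos_of_ne_zero hb0) he).trans hE)
  obtain ⟨L, hL, hDL⟩ := exists_eq_divisors D ((hmem 1).mpr (by simp))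
    (fun h => by simp [D] at h)
    (fun e he d hd => by
      rw [hmem] at he ⊢
      exact ⟨he.1.coprime_dvd_left hd, (pow_dvd_pow_of_dvd hd 2).trans he.2⟩)
    (fun d hd e he => by
      rw [hmem] at hd he ⊢
      exact ⟨(hd.1.mul_left he.1).coprime_dvd_left (Nat.lcm_dvd_mul d e),
        by rw [← Nat.pow_lcm_pow]; exact Nat.lcm_dvd hd.2 he.2⟩)
  rw [hDL, sum_divisors_moebius]
  refine if_congr ⟨?_, ?_⟩ rfl rfl
  · rintro rfl p hp hpN hpb
    have : p ∈ D := (hmem p).mpr ⟨(Nat.Prime.coprime_iff_not_dvd hp).mpr hpN, hpb⟩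
    rw [hDL, Nat.divisors_one, mem_singleton] at this
    exact hp.ne_one this
  · intro h
    by_contra hL1
    have hq := Nat.minFac_prime hL1
    have : L.minFac ∈ D := by
      rw [hDL, Nat.mem_divisors]
      exact ⟨Nat.minFac_dvd L, fun h0 => by
        rw [hmem, h0] at hL
        exact hb0 (by simpa using hL.2)⟩
    rw [hmem] at this
    exact h _ hq ((Nat.Prime.coprime_iff_not_dvd hq).mp this.1) this.2

theorem abs_card_modEq_sub_le (A₀ M : ℕ) {q : ℕ} (hq : 0 < q) (v : ℤ) :
    |(#{A ∈ Ioc A₀ M | ((A : ℕ) : ℤ) ≡ v [ZMOD q]} : ℝ) - M / q| ≤ A₀ + 1 := by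
  obtain ⟨w, hw⟩ : ∃ w : ℕ, (w : ℤ) ≡ v [ZMOD q] :=
    ⟨(v % q).toNat, by
      rw [Int.toNat_of_nonneg (Int.emod_nonneg v (by positivity))]; exact Int.mod_modEq v q⟩
  have hfilter : {A ∈ Ioc A₀ M | ((A : ℕ) : ℤ) ≡ v [ZMOD q]} = {A ∈ Ioc A₀ M | A ≡ w [MOD q]} := by
    refine filter_congr fun A _ => ?_
    rw [← Int.natCast_modEq_iff]
    exact ⟨fun h => h.trans hw.symm, fun h => h.trans hw⟩
  rw [hfilter]
  have hcard := Nat.Ioc_filter_modEq_card A₀ M hq w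
  have hqR : (0 : ℝ) < q := by exact_mod_cast hq
  have hq1 : (1 : ℝ) ≤ q := by exact_mod_cast hq
  have hA₀ : (0 : ℝ) ≤ A₀ := by positivity
  have hdiv : (A₀ : ℝ) / q ≤ A₀ := div_le_self hA₀ hq1
  have hdiv0 : 0 ≤ (A₀ : ℝ) / q := by positivity
  rcases le_total A₀ M with h | h
  · have h1 : ⌊((A₀ : ℚ) - w) / q⌋ ≤ ⌊((M : ℚ) - w) / q⌋ := by
      apply Int.floor_mono
      have : (A₀ : ℚ) ≤ M := by exact_mod_cast h
      gcongr
    rw [max_eq_left (by omega)] at hcard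
    have h2 : |(#{A ∈ Ioc A₀ M | A ≡ w [MOD q]} : ℚ) - (M - A₀) / q| ≤ 1 := by
      have h3 : (#{A ∈ Ioc A₀ M | A ≡ w [MOD q]} : ℚ) =
          ⌊((M : ℚ) - w) / q⌋ - ⌊((A₀ : ℚ) - w) / q⌋ := by exact_mod_cast hcard
      rw [h3, abs_le]
      have h4 := Int.floor_le (((M : ℚ) - w) / q)
      have h5 := Int.lt_floor_add_one (((M : ℚ) - w) / q)
      have h6 := Int.floor_le (((A₀ : ℚ) - w) / q)
      have h7 := Int.lt_floor_add_one (((A₀ : ℚ) - w) / q)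
      have h8 : ((M : ℚ) - A₀) / q = ((M : ℚ) - w) / q - ((A₀ : ℚ) - w) / q := by ring
      rw [h8]
      constructor <;> linarith
    have h9 : |(#{A ∈ Ioc A₀ M | A ≡ w [MOD q]} : ℝ) - (M - A₀) / q| ≤ 1 := by
      have := (Rat.cast_le (K := ℝ)).mpr h2
      simpa using this
    rw [sub_div] at h9
    rw [abs_le] at h9 ⊢
    constructor <;> linarith
  · rw [Ioc_eq_empty (not_lt.mpr h), filter_empty, card_empty, Nat.cast_zero, zero_sub, abs_neg,
      abs_of_nonneg (by positivity)]
    have : (M : ℝ) / q ≤ A₀ / q := by gcongr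
    linarith

theorem exists_dvd_sub_of_isCoprime {a b : ℤ} (h : IsCoprime a b) (x y : ℤ) :
    ∃ z, a ∣ z - x ∧ b ∣ z - y := by
  obtain ⟨s, t, hst⟩ := h
  exact ⟨x * (t * b) + y * (s * a), ⟨s * (y - x), by linear_combination x * hst⟩,
    ⟨t * (x - y), by linear_combination y * hst⟩⟩

/-- Chinese remainder theorem applied twice; since u is invertible modulo e², the last condition is
A ≡ c/u mod e². -/
theorem exists_forall_iff_modEq {κ d e : ℕ} {c u : ℤ} (hκd : κ.Coprime d) (hκe : κ.Coprime e)
    (hde : d.Coprime e) (hu : IsCoprime (e : ℤ) u) :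
    ∃ v : ℤ, ∀ A : ℤ, (A ≡ -1 [ZMOD (κ : ℤ) ^ 2] ∧ (d : ℤ) ^ 2 ∣ A ∧ (e : ℤ) ^ 2 ∣ c - u * A) ↔
      A ≡ v [ZMOD ((κ ^ 2 * (d ^ 2 * e ^ 2) : ℕ) : ℤ)] := by
  obtain ⟨x, y, hxy⟩ := hu.pow_left (m := 2)
  have hde' : IsCoprime ((d : ℤ) ^ 2) ((e : ℤ) ^ 2) := (Nat.isCoprime_iff_coprime.mpr hde).pow
  obtain ⟨w, hw1, hw2⟩ := exists_dvd_sub_of_isCoprime hde' 0 (y * c)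
  have hκde : κ.Coprime (d * e) := hκd.mul_right hκe
  have hκde' : IsCoprime ((κ : ℤ) ^ 2) ((d : ℤ) ^ 2 * (e : ℤ) ^ 2) := by
    rw [← mul_pow]
    exact_mod_cast (Nat.isCoprime_iff_coprime.mpr hκde).pow (m := 2) (n := 2)
  obtain ⟨v, hv1, hv2⟩ := exists_dvd_sub_of_isCoprime hκde' (-1) w
  have hvd : (d : ℤ) ^ 2 ∣ v := by
    have := dvd_add ((dvd_mul_right _ _).trans hv2) hw1
    simpa using this
  have hve : (e : ℤ) ^ 2 ∣ v - y * c := by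
    have := dvd_add ((dvd_mul_left _ _).trans hv2) hw2
    simpa using this
  refine ⟨v, fun A => ?_⟩
  push_cast
  rw [← Int.modEq_and_modEq_iff_modEq_mul (by
      rw [← Int.isCoprime_iff_nat_coprime]; exact hκde'),
    ← Int.modEq_and_modEq_iff_modEq_mul (by
      rw [← Int.isCoprime_iff_nat_coprime]; exact hde')]
  have hv1' : v ≡ -1 [ZMOD (κ : ℤ) ^ 2] := ((Int.modEq_iff_dvd).mpr hv1).symm
  refine and_congr ⟨fun h => h.trans hv1'.symm, fun h => h.trans hv1'⟩ (and_congr ?_ ?_)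
  · rw [Int.modEq_comm, Int.modEq_iff_dvd]
    exact (dvd_sub_left hvd).symm
  · rw [Int.modEq_comm, Int.modEq_iff_dvd]
    have h1 : c - u * A = e ^ 2 * (x * c) - u * (v - y * c) - u * (A - v) := by
      linear_combination -c * hxy
    rw [h1, dvd_sub_right (dvd_sub (dvd_mul_right _ _) (dvd_mul_of_dvd_right hve u))]
    exact ⟨fun h => IsCoprime.dvd_of_dvd_mul_left hu.pow_left h, fun h => dvd_mul_of_dvd_right h u⟩

theorem sum_Ioc_zero_inv_sq_le (Y : ℕ) : ∑ d ∈ Ioc 0 Y, ((d : ℝ) ^ 2)⁻¹ ≤ 2 := by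
  rcases Nat.eq_zero_or_pos Y with rfl | hY
  · simp
  · rw [← sum_Ioc_consecutive _ zero_le_one hY]
    have h1 := sum_Ioc_inv_sq_le_sub (α := ℝ) one_ne_zero hY
    have h2 : 0 ≤ ((Y : ℝ))⁻¹ := by positivity
    have h3 : ∑ d ∈ Ioc 0 (1 : ℕ), ((d : ℝ) ^ 2)⁻¹ = 1 := by simp [show Ioc 0 1 = {1} from rfl]
    rw [Nat.cast_one, inv_one] at h1
    linarith

theorem sum_Ioc_inv_sq_le_inv {Y : ℕ} (hY : Y ≠ 0) (E : ℕ) :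
    ∑ d ∈ Ioc Y E, ((d : ℝ) ^ 2)⁻¹ ≤ (Y : ℝ)⁻¹ := by
  rcases le_total Y E with h | h
  · have h1 := sum_Ioc_inv_sq_le_sub (α := ℝ) hY h
    have h2 : 0 ≤ ((E : ℝ))⁻¹ := by positivity
    linarith
  · rw [Ioc_eq_empty (not_lt.mpr h), sum_empty]
    positivity

/-- The weights `μ(de) / (de) ^ 2`, for `d` coprime to `κ` and `e` coprime to `N`. -/
noncomputable def sieveWeight (κ N : ℕ) (x : ℕ × ℕ) : ℝ :=
  if x.1.Coprime κ ∧ x.2.Coprime N then (μ (x.1 * x.2) : ℝ) / ((x.1 : ℝ) ^ 2 * (x.2 : ℝ) ^ 2) else 0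

theorem abs_sieveWeight_le (κ N : ℕ) (x : ℕ × ℕ) :
    |sieveWeight κ N x| ≤ ((x.1 : ℝ) ^ 2)⁻¹ * ((x.2 : ℝ) ^ 2)⁻¹ := by
  rw [sieveWeight]
  split_ifs
  · rw [abs_div, abs_of_nonneg (by positivity : 0 ≤ (x.1 : ℝ) ^ 2 * (x.2 : ℝ) ^ 2), ← mul_inv,
      div_eq_mul_inv]
    refine mul_le_of_le_one_left (by positivity) ?_
    exact_mod_cast abs_moebius_le_one
  · rw [abs_zero]
    positivity

theorem summable_inv_sq : Summable fun d : ℕ => ((d : ℝ) ^ 2)⁻¹ :=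
  Real.summable_nat_pow_inv.mpr one_lt_two

theorem summable_inv_sq_mul_inv_sq :
    Summable fun x : ℕ × ℕ => ((x.1 : ℝ) ^ 2)⁻¹ * ((x.2 : ℝ) ^ 2)⁻¹ :=
  summable_inv_sq.mul_of_nonneg summable_inv_sq (fun _ => by positivity) (fun _ => by positivity)

theorem summable_sieveWeight (κ N : ℕ) : Summable (sieveWeight κ N) :=
  Summable.of_norm_bounded summable_inv_sq_mul_inv_sq (abs_sieveWeight_le κ N)

theorem tsum_inv_sq_sub_sum_le {Y : ℕ} (hY : Y ≠ 0) :
    ∑' d : ℕ, ((d : ℝ) ^ 2)⁻¹ ≤ ∑ d ∈ Ioc 0 Y, ((d : ℝ) ^ 2)⁻¹ + (Y : ℝ)⁻¹ := by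
  refine summable_inv_sq.tsum_le_of_sum_le fun s => ?_
  obtain ⟨E, hE⟩ := s.exists_nat_subset_range
  -- The index 0 contributes nothing, since 0⁻¹ = 0.
  have h1 : ∑ d ∈ s, ((d : ℝ) ^ 2)⁻¹ ≤ ∑ d ∈ insert 0 (Ioc 0 (Y + E)), ((d : ℝ) ^ 2)⁻¹ := by
    refine sum_le_sum_of_subset_of_nonneg (fun d hd => ?_) fun _ _ _ => by positivity
    have := mem_range.mp (hE hd)
    rw [mem_insert, mem_Ioc]
    omega
  rw [sum_insert (by simp), ← sum_Ioc_consecutive _ (Nat.zero_le Y) (Nat.le_add_right Y E)] at h1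
  have h2 := sum_Ioc_inv_sq_le_inv hY (Y + E)
  norm_num at h1
  linarith

/-- With Z the full sum of d⁻² and S its part up to Y, the tail is at most Z² - S² = (Z - S)(Z + S),
where Z - S ≤ 1/Y and Z + S ≤ 2S + 1/Y ≤ 5. -/
theorem abs_tsum_sieveWeight_sub_sum_le (κ N : ℕ) {Y : ℕ} (hY : Y ≠ 0) :
    |∑ x ∈ Ioc 0 Y ×ˢ Ioc 0 Y, sieveWeight κ N x - ∑' x, sieveWeight κ N x| ≤ 5 * (Y : ℝ)⁻¹ := by
  set h : ℕ × ℕ → ℝ := fun x => ((x.1 : ℝ) ^ 2)⁻¹ * ((x.2 : ℝ) ^ 2)⁻¹ with hh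
  set s := Ioc 0 Y ×ˢ Ioc 0 Y
  have hw := summable_sieveWeight κ N
  have h1 := hw.sum_add_tsum_subtype_compl s
  have h2 := summable_inv_sq_mul_inv_sq.sum_add_tsum_subtype_compl s
  rw [abs_sub_comm, ← h1, add_sub_cancel_left]
  have h3 : ‖∑' x : {x // x ∉ s}, sieveWeight κ N x‖ ≤ ∑' x : {x // x ∉ s}, h x := by
    have hs : HasSum (fun x : {x // x ∉ s} => h x) _ :=
      (summable_inv_sq_mul_inv_sq.subtype {x | x ∉ s}).hasSum
    exact tsum_of_norm_bounded hs fun x => abs_sieveWeight_le κ N x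
  refine h3.trans ?_
  set Z := ∑' d : ℕ, ((d : ℝ) ^ 2)⁻¹
  set S := ∑ d ∈ Ioc 0 Y, ((d : ℝ) ^ 2)⁻¹
  have h4 : ∑' x, h x = Z * Z :=
    (summable_inv_sq.tsum_mul_tsum summable_inv_sq summable_inv_sq_mul_inv_sq).symm
  have h5 : ∑ x ∈ s, h x = S * S := by
    rw [sum_mul_sum, ← sum_product']
  have hZS : Z ≤ S + (Y : ℝ)⁻¹ := tsum_inv_sq_sub_sum_le hY
  have hSZ : S ≤ Z := summable_inv_sq.sum_le_tsum _ fun _ _ => by positivity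
  have hS : S ≤ 2 := sum_Ioc_zero_inv_sq_le Y
  have hS0 : 0 ≤ S := sum_nonneg fun _ _ => by positivity
  have hY1 : (Y : ℝ)⁻¹ ≤ 1 := inv_le_one_of_one_le₀ (by exact_mod_cast Nat.pos_of_ne_zero hY)
  have hY0 : 0 ≤ (Y : ℝ)⁻¹ := by positivity
  have h6 : ∑' x : {x // x ∉ s}, h x = Z * Z - S * S := by
    rw [← h4, ← h5]
    linarith [h2]
  rw [h6]
  nlinarith

end Sieve

/-! ### The sieve and its error terms -/

section SieveCount

open Finset ArithmeticFunction
open scoped ArithmeticFunction.Moebius Classical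

/-- The integers of `(A₀, M]` congruent to `-1` modulo `κ ^ 2`. -/
noncomputable def residueSet (κ A₀ M : ℕ) : Finset ℕ :=
  {A ∈ Ioc A₀ M | ((A : ℕ) : ℤ) ≡ -1 [ZMOD (κ : ℤ) ^ 2]}

/-- The `e`-th term of the Möbius sum detecting that `b` is not divisible by the square of a prime
not dividing `N`. -/
noncomputable def moebiusTerm (N : ℕ) (b : ℤ) (e : ℕ) : ℝ :=
  if e.Coprime N ∧ (e : ℤ) ^ 2 ∣ b then (μ e : ℝ) else 0

theorem abs_moebiusTerm_le (N : ℕ) (b : ℤ) (e : ℕ) :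
    |moebiusTerm N b e| ≤ if e.Coprime N ∧ (e : ℤ) ^ 2 ∣ b then 1 else 0 := by
  rw [moebiusTerm]
  split_ifs
  · exact_mod_cast abs_moebius_le_one
  · simp

variable {κ N : ℕ} {c u : ℤ}

/-- The number of `A` in `residueSet` with `d ^ 2 ∣ A` and `e ^ 2 ∣ c - u A`. -/
noncomputable def pairCount (κ A₀ M : ℕ) (c u : ℤ) (d e : ℕ) : ℕ :=
  #{A ∈ residueSet κ A₀ M | (d : ℤ) ^ 2 ∣ (A : ℕ) ∧ (e : ℤ) ^ 2 ∣ c - u * (A : ℕ)}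

/-- A common prime of d and e would divide A and c - uA, hence c, which is prime to e. -/
theorem pairCount_eq_zero (hc : ∀ e : ℕ, e.Coprime N → IsCoprime (e : ℤ) c) (A₀ M : ℕ) {d e : ℕ}
    (he : e.Coprime N) (hde : ¬ d.Coprime e) : pairCount κ A₀ M c u d e = 0 := by
  rw [pairCount, card_eq_zero, filter_eq_empty_iff]
  rintro A - ⟨hd, hB⟩
  obtain ⟨p, hp, hpd, hpe⟩ := Nat.Prime.not_coprime_iff_dvd.mp hde
  have hpd' : (p : ℤ) ∣ (d : ℤ) ^ 2 := (Int.natCast_dvd_natCast.mpr hpd).trans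
    (dvd_pow_self _ two_ne_zero)
  have hpe' : (p : ℤ) ∣ (e : ℤ) ^ 2 := (Int.natCast_dvd_natCast.mpr hpe).trans
    (dvd_pow_self _ two_ne_zero)
  have h1 : (p : ℤ) ∣ c := (dvd_sub_left (dvd_mul_of_dvd_right (hpd'.trans hd) u)).mp
    (hpe'.trans hB)
  have h2 := (hc e he).isUnit_of_dvd' (Int.natCast_dvd_natCast.mpr hpe) h1
  exact (Nat.prime_iff_prime_int.mp hp).not_isUnit h2

theorem abs_pairCount_sub_le (hκ : κ ≠ 0) (hκN : κ ∣ N)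
    (hu : ∀ e : ℕ, e.Coprime N → IsCoprime (e : ℤ) u) (A₀ M : ℕ) {d e : ℕ} (hd0 : d ≠ 0)
    (he0 : e ≠ 0) (hd : d.Coprime κ) (he : e.Coprime N) (hde : d.Coprime e) :
    |(pairCount κ A₀ M c u d e : ℝ) - M / (κ : ℝ) ^ 2 * ((d : ℝ) ^ 2 * (e : ℝ) ^ 2)⁻¹| ≤ A₀ + 1 := by
  obtain ⟨v, hv⟩ := exists_forall_iff_modEq (c := c) hd.symm (he.coprime_dvd_right hκN).symm hde
    (hu e he)
  have h1 : pairCount κ A₀ M c u d e =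
      #{A ∈ Ioc A₀ M | ((A : ℕ) : ℤ) ≡ v [ZMOD ((κ ^ 2 * (d ^ 2 * e ^ 2) : ℕ) : ℤ)]} := by
    rw [pairCount, residueSet, filter_filter]
    exact congrArg _ (filter_congr fun A _ => hv A)
  have h2 := abs_card_modEq_sub_le A₀ M (q := κ ^ 2 * (d ^ 2 * e ^ 2)) (by positivity) v
  rw [h1, ← div_eq_mul_inv, div_div]
  exact_mod_cast h2

theorem pairCount_le (hκ : κ ≠ 0) (hκN : κ ∣ N)
    (hu : ∀ e : ℕ, e.Coprime N → IsCoprime (e : ℤ) u)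
    (hc : ∀ e : ℕ, e.Coprime N → IsCoprime (e : ℤ) c) (A₀ M : ℕ) {d e : ℕ} (hd0 : d ≠ 0)
    (he0 : e ≠ 0) (hd : d.Coprime κ) (he : e.Coprime N) :
    (pairCount κ A₀ M c u d e : ℝ) ≤ M * (((d : ℝ) ^ 2)⁻¹ * ((e : ℝ) ^ 2)⁻¹) + (A₀ + 1) := by
  by_cases hde : d.Coprime e
  · have h1 := (abs_le.mp (abs_pairCount_sub_le (c := c) hκ hκN hu A₀ M hd0 he0 hd he hde)).2
    have hκ1 : (1 : ℝ) ≤ (κ : ℝ) ^ 2 := one_le_pow₀ (by exact_mod_cast Nat.pos_of_ne_zero hκ)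
    have h2 : (M : ℝ) / (κ : ℝ) ^ 2 * ((d : ℝ) ^ 2 * (e : ℝ) ^ 2)⁻¹ ≤
        M * (((d : ℝ) ^ 2)⁻¹ * ((e : ℝ) ^ 2)⁻¹) := by
      rw [mul_inv]
      exact mul_le_mul_of_nonneg_right (div_le_self (by positivity) hκ1) (by positivity)
    linarith
  · rw [pairCount_eq_zero hc A₀ M he hde, Nat.cast_zero]
    positivity

theorem sum_moebiusTerm_mul_moebiusTerm (A₀ M : ℕ) (s s' : Finset ℕ) :
    ∑ A ∈ residueSet κ A₀ M, (∑ d ∈ s, moebiusTerm κ A d) * ∑ e ∈ s', moebiusTerm N (c - u * A) e =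
      ∑ d ∈ s, ∑ e ∈ s', (if d.Coprime κ ∧ e.Coprime N then (μ d : ℝ) * μ e else 0) *
        pairCount κ A₀ M c u d e := by
  simp_rw [sum_mul_sum]
  rw [sum_comm]
  refine sum_congr rfl fun d _ => ?_
  rw [sum_comm]
  refine sum_congr rfl fun e _ => ?_
  rw [pairCount, card_filter, Nat.cast_sum, mul_sum]
  refine sum_congr rfl fun A _ => ?_
  simp only [moebiusTerm, Nat.cast_ite, Nat.cast_one, Nat.cast_zero]
  split_ifs <;> simp_all

/-- Each of the Y² pairs costs at most A₀ + 1. Non-coprime pairs vanish on both sides: their count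
is zero, and so is μ(de). -/
theorem abs_sum_moebiusTerm_mul_sub_le (hκ : κ ≠ 0) (hκN : κ ∣ N)
    (hu : ∀ e : ℕ, e.Coprime N → IsCoprime (e : ℤ) u)
    (hc : ∀ e : ℕ, e.Coprime N → IsCoprime (e : ℤ) c) (A₀ M Y : ℕ) :
    |∑ A ∈ residueSet κ A₀ M, (∑ d ∈ Ioc 0 Y, moebiusTerm κ A d) *
          ∑ e ∈ Ioc 0 Y, moebiusTerm N (c - u * A) e -
        M / (κ : ℝ) ^ 2 * ∑ x ∈ Ioc 0 Y ×ˢ Ioc 0 Y, sieveWeight κ N x| ≤ (A₀ + 1) * (Y : ℝ) ^ 2 := by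
  rw [sum_moebiusTerm_mul_moebiusTerm, ← sum_product', mul_sum, ← sum_sub_distrib]
  have hterm : ∀ x ∈ Ioc 0 Y ×ˢ Ioc 0 Y,
      |(if x.1.Coprime κ ∧ x.2.Coprime N then (μ x.1 : ℝ) * μ x.2 else 0) *
        pairCount κ A₀ M c u x.1 x.2 - M / (κ : ℝ) ^ 2 * sieveWeight κ N x| ≤ A₀ + 1 := by
    rintro ⟨d, e⟩ hx
    simp only [mem_product, mem_Ioc] at hx
    rw [sieveWeight]
    split_ifs with hcop
    · by_cases hde : d.Coprime e
      · have h1 := abs_pairCount_sub_le (c := c) hκ hκN hu A₀ M (by omega) (by omega) hcop.1 hcop.2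
          hde
        have h2 : (μ (d * e) : ℝ) = μ d * μ e := by
          exact_mod_cast isMultiplicative_moebius.map_mul_of_coprime hde
        have h3 : |(μ d : ℝ) * μ e| ≤ 1 := by
          rw [← h2]
          exact_mod_cast abs_moebius_le_one
        have h4 : (μ d : ℝ) * μ e * pairCount κ A₀ M c u d e -
            M / (κ : ℝ) ^ 2 * ((μ (d * e) : ℝ) / ((d : ℝ) ^ 2 * (e : ℝ) ^ 2)) =
            (μ d * μ e) * (pairCount κ A₀ M c u d e -
              M / (κ : ℝ) ^ 2 * ((d : ℝ) ^ 2 * (e : ℝ) ^ 2)⁻¹) := by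
          rw [h2]; ring
        simp only [h4]
        rw [abs_mul]
        exact (mul_le_of_le_one_left (abs_nonneg _) h3).trans h1
      · have h2 : μ (d * e) = 0 := moebius_eq_zero_of_not_squarefree
          fun h => hde (Nat.coprime_of_squarefree_mul h)
        simp only [h2, pairCount_eq_zero hc A₀ M hcop.2 hde]
        simp
        positivity
    · simp
      positivity
  refine (abs_sum_le_sum_abs _ _).trans ((sum_le_card_nsmul _ _ _ hterm).trans (le_of_eq ?_))
  rw [card_product, Nat.card_Ioc, nsmul_eq_mul, Nat.sub_zero]
  push_cast
  ring

/-- For large d the residue class and the condition on c - uA are dropped; at most M/d² multiples of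
d² remain. -/
theorem sum_abs_sum_moebiusTerm_le (A₀ M : ℕ) {Y : ℕ} (hY : Y ≠ 0) (E : ℕ) :
    ∑ A ∈ residueSet κ A₀ M, |∑ d ∈ Ioc Y E, moebiusTerm κ A d| ≤ M * (Y : ℝ)⁻¹ := by
  calc ∑ A ∈ residueSet κ A₀ M, |∑ d ∈ Ioc Y E, moebiusTerm κ A d|
      ≤ ∑ A ∈ Ioc 0 M, ∑ d ∈ Ioc Y E, (if d ^ 2 ∣ A then (1 : ℝ) else 0) := by
        have hnn : ∀ A : ℕ, 0 ≤ ∑ d ∈ Ioc Y E, (if d ^ 2 ∣ A then (1 : ℝ) else 0) := fun A =>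
          sum_nonneg fun d _ => by split_ifs <;> norm_num
        refine le_trans (sum_le_sum (g := fun A => ∑ d ∈ Ioc Y E, (if d ^ 2 ∣ A then (1 : ℝ) else 0))
          fun A _ => (abs_sum_le_sum_abs _ _).trans (sum_le_sum fun d _ =>
          (abs_moebiusTerm_le κ A d).trans ?_))
          (sum_le_sum_of_subset_of_nonneg ?_ fun A _ _ => hnn A)
        · have : (d : ℤ) ^ 2 ∣ A ↔ d ^ 2 ∣ A := by exact_mod_cast Int.natCast_dvd_natCast
          simp only [this]
          split_ifs <;> simp_all
        · intro A hA
          rw [residueSet, mem_filter, mem_Ioc] at hA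
          rw [mem_Ioc]
          omega
    _ = ∑ d ∈ Ioc Y E, ((M / d ^ 2 : ℕ) : ℝ) := by
        rw [sum_comm]
        refine sum_congr rfl fun d _ => ?_
        rw [← Nat.Ioc_filter_dvd_card_eq_div, card_filter]
        push_cast
        rfl
    _ ≤ ∑ d ∈ Ioc Y E, (M : ℝ) * ((d : ℝ) ^ 2)⁻¹ := by
        refine sum_le_sum fun d _ => Nat.cast_div_le.trans (le_of_eq ?_)
        push_cast
        rw [div_eq_mul_inv]
    _ ≤ M * (Y : ℝ)⁻¹ := by
        rw [← mul_sum]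
        exact mul_le_mul_of_nonneg_left (sum_Ioc_inv_sq_le_inv hY E) (by positivity)

/-- The main terms sum to at most 2M/Y by the tail in e, and there are at most Y·E bounded error
terms. Keeping d ≤ Y here is what makes that number affordable. -/
theorem sum_abs_mul_abs_moebiusTerm_le (hκ : κ ≠ 0) (hκN : κ ∣ N)
    (hu : ∀ e : ℕ, e.Coprime N → IsCoprime (e : ℤ) u)
    (hc : ∀ e : ℕ, e.Coprime N → IsCoprime (e : ℤ) c) (A₀ M : ℕ) {Y : ℕ} (hY : Y ≠ 0) (E : ℕ) :
    ∑ A ∈ residueSet κ A₀ M, |∑ d ∈ Ioc 0 Y, moebiusTerm κ A d| *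
        |∑ e ∈ Ioc Y E, moebiusTerm N (c - u * A) e| ≤
      2 * (M * (Y : ℝ)⁻¹) + (A₀ + 1) * (Y * E) := by
  calc ∑ A ∈ residueSet κ A₀ M, |∑ d ∈ Ioc 0 Y, moebiusTerm κ A d| *
        |∑ e ∈ Ioc Y E, moebiusTerm N (c - u * A) e|
      ≤ ∑ A ∈ residueSet κ A₀ M, ∑ d ∈ Ioc 0 Y, ∑ e ∈ Ioc Y E,
          (if d.Coprime κ ∧ e.Coprime N then (1 : ℝ) else 0) *
            if (d : ℤ) ^ 2 ∣ A ∧ (e : ℤ) ^ 2 ∣ c - u * A then 1 else 0 := by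
        refine sum_le_sum fun A _ => ?_
        refine (mul_le_mul (abs_sum_le_sum_abs _ _) (abs_sum_le_sum_abs _ _) (abs_nonneg _)
          (sum_nonneg fun _ _ => abs_nonneg _)).trans ?_
        rw [sum_mul_sum]
        refine sum_le_sum fun d _ => sum_le_sum fun e _ => ?_
        refine (mul_le_mul (abs_moebiusTerm_le κ A d) (abs_moebiusTerm_le N _ e) (abs_nonneg _)
          (by positivity)).trans (le_of_eq ?_)
        split_ifs <;> simp_all
    _ = ∑ d ∈ Ioc 0 Y, ∑ e ∈ Ioc Y E, (if d.Coprime κ ∧ e.Coprime N then (1 : ℝ) else 0) *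
          pairCount κ A₀ M c u d e := by
        rw [sum_comm]
        refine sum_congr rfl fun d _ => ?_
        rw [sum_comm]
        refine sum_congr rfl fun e _ => ?_
        rw [← mul_sum, pairCount, card_filter]
        push_cast
        rfl
    _ ≤ ∑ d ∈ Ioc 0 Y, ∑ e ∈ Ioc Y E,
          (M * (((d : ℝ) ^ 2)⁻¹ * ((e : ℝ) ^ 2)⁻¹) + ((A₀ : ℝ) + 1)) := by
        refine sum_le_sum fun d hd => sum_le_sum fun e he => ?_
        rw [mem_Ioc] at hd he
        split_ifs with hcop
        · rw [one_mul]
          exact pairCount_le hκ hκN hu hc A₀ M (by omega) (by omega) hcop.1 hcop.2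
        · rw [zero_mul]
          positivity
    _ = M * ((∑ d ∈ Ioc 0 Y, ((d : ℝ) ^ 2)⁻¹) * ∑ e ∈ Ioc Y E, ((e : ℝ) ^ 2)⁻¹) +
          (A₀ + 1) * (Y * (E - Y : ℕ)) := by
        simp_rw [sum_add_distrib, ← mul_sum, ← sum_mul]
        simp only [sum_const, Nat.card_Ioc, nsmul_eq_mul, Nat.sub_zero]
        ring
    _ ≤ 2 * (M * (Y : ℝ)⁻¹) + (A₀ + 1) * (Y * E) := by
        have h1 := mul_le_mul (sum_Ioc_zero_inv_sq_le Y) (sum_Ioc_inv_sq_le_inv hY E)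
          (sum_nonneg fun _ _ => by positivity) zero_le_two
        have h2 : ((E - Y : ℕ) : ℝ) ≤ E := by exact_mod_cast Nat.sub_le E Y
        have h3 := mul_le_mul_of_nonneg_left h1 (Nat.cast_nonneg (α := ℝ) M)
        have h4 : ((A₀ : ℝ) + 1) * (Y * (E - Y : ℕ)) ≤ (A₀ + 1) * (Y * E) := by gcongr
        linarith

/-- The integers of `residueSet` that are squarefree and for which `c - u A` is not divisible by
the square of a prime not dividing `N`. -/
noncomputable def siftedSet (κ N A₀ M : ℕ) (c u : ℤ) : Finset ℕ :=
  {A ∈ residueSet κ A₀ M | Squarefree A ∧ ∀ p : ℕ, p.Prime → ¬ p ∣ N → ¬ (p : ℤ) ^ 2 ∣ c - u * A}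

theorem mem_siftedSet {A₀ M A : ℕ} : A ∈ siftedSet κ N A₀ M c u ↔
    ((A₀ < A ∧ A ≤ M) ∧ (A : ℤ) ≡ -1 [ZMOD (κ : ℤ) ^ 2]) ∧
      Squarefree A ∧ ∀ p : ℕ, p.Prime → ¬ p ∣ N → ¬ (p : ℤ) ^ 2 ∣ c - u * A := by
  rw [siftedSet, residueSet, mem_filter, mem_filter, mem_Ioc]

theorem squarefree_iff_of_modEq_neg_one {A : ℕ} (hA : (A : ℤ) ≡ -1 [ZMOD (κ : ℤ) ^ 2]) :
    Squarefree A ↔ ∀ p : ℕ, p.Prime → ¬ p ∣ κ → ¬ (p : ℤ) ^ 2 ∣ A := by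
  have hcast : ∀ p : ℕ, (p : ℤ) ^ 2 ∣ A ↔ p * p ∣ A := fun p => by
    rw [← pow_two]
    exact_mod_cast Int.natCast_dvd_natCast
  rw [Nat.squarefree_iff_prime_squarefree]
  simp only [hcast]
  refine ⟨fun h p hp _ => h p hp, fun h p hp hpA => h p hp (fun hpκ => ?_) hpA⟩
  have h1 : (p : ℤ) ∣ A := Int.natCast_dvd_natCast.mpr ((dvd_mul_right p p).trans hpA)
  have h2 : (p : ℤ) ∣ -1 - A := ((Int.natCast_dvd_natCast.mpr hpκ).trans
    (dvd_pow_self _ two_ne_zero)).trans hA.dvd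
  have h3 := dvd_add h2 h1
  rw [sub_add_cancel, dvd_neg] at h3
  exact (Nat.prime_iff_prime_int.mp hp).not_dvd_one h3

theorem exists_abs_card_siftedSet_sub_le (hκ : κ ≠ 0) (hκN : κ ∣ N)
    (hu : ∀ e : ℕ, e.Coprime N → IsCoprime (e : ℤ) u)
    (hc : ∀ e : ℕ, e.Coprime N → IsCoprime (e : ℤ) c) (A₀ : ℕ)
    (hA₀ : ∀ A : ℕ, A₀ < A → c - u * A ≠ 0) :
    ∃ K : ℝ, 0 ≤ K ∧ ∀ Y M : ℕ, Y ≠ 0 → M ≤ 16 * Y ^ 4 →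
      |(#(siftedSet κ N A₀ M c u) : ℝ) - M / (κ : ℝ) ^ 2 * ∑' x, sieveWeight κ N x| ≤
        K * (Y : ℝ) ^ 3 := by
  set k := c.natAbs + u.natAbs + 1 with hk
  refine ⟨128 + (A₀ + 1) * (4 * k + 1), by positivity, fun Y M hY hM => ?_⟩
  -- This choice gives E² ≥ 16kY⁴, which bounds both A and |c - uA| for A ≤ M. In the constant, 128
  -- = (1 + 2 + 5)·16 collects the M/Y terms.
  set E := 4 * k * Y ^ 2 with hE
  have hYpos := Nat.pos_of_ne_zero hY
  have hYE : Y ≤ E := by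
    have h1 : 1 ≤ 4 * k * Y := Nat.mul_pos (by omega) hYpos
    have h2 : E = 4 * k * Y * Y := by rw [hE]; ring
    rw [h2]
    exact Nat.le_mul_of_pos_left Y h1
  have hE2 : k * (16 * Y ^ 4) ≤ E ^ 2 := by
    have h1 : E ^ 2 = k * (16 * Y ^ 4) * k := by rw [hE]; ring
    rw [h1]
    exact Nat.le_mul_of_pos_right _ (by omega)
  set S := fun A : ℕ => ∑ d ∈ Ioc 0 Y, moebiusTerm κ A d
  set S' := fun A : ℕ => ∑ d ∈ Ioc Y E, moebiusTerm κ A d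
  set T := fun A : ℕ => ∑ e ∈ Ioc 0 Y, moebiusTerm N (c - u * A) e
  set T' := fun A : ℕ => ∑ e ∈ Ioc Y E, moebiusTerm N (c - u * A) e
  have hST : ∀ A ∈ residueSet κ A₀ M,
      S A + S' A = (if Squarefree A then 1 else 0) ∧ T A + T' A =
        if ∀ p : ℕ, p.Prime → ¬ p ∣ N → ¬ (p : ℤ) ^ 2 ∣ c - u * A then 1 else 0 := by
    intro A hA
    rw [residueSet, mem_filter, mem_Ioc] at hA
    have hAM : A ≤ 16 * Y ^ 4 := hA.1.2.trans hM
    constructor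
    · simp only [S, S']
      rw [sum_Ioc_consecutive _ (Nat.zero_le Y) hYE]
      refine (sum_moebius_sq_dvd (by omega) κ E ?_).trans
        (if_congr (squarefree_iff_of_modEq_neg_one hA.2).symm rfl rfl)
      rw [Int.natAbs_natCast]
      exact hAM.trans ((Nat.le_mul_of_pos_left _ (by omega)).trans hE2)
    · simp only [T, T']
      rw [sum_Ioc_consecutive _ (Nat.zero_le Y) hYE]
      refine sum_moebius_sq_dvd (hA₀ A hA.1.1) N E ((Int.natAbs_sub_le _ _).trans ?_)
      rw [Int.natAbs_mul, Int.natAbs_natCast]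
      refine le_trans ?_ hE2
      have h1 : 1 ≤ 16 * Y ^ 4 := by have := pow_pos hYpos 4; omega
      calc c.natAbs + u.natAbs * A ≤ c.natAbs * (16 * Y ^ 4) + u.natAbs * (16 * Y ^ 4) :=
            add_le_add (Nat.le_mul_of_pos_right _ h1) (Nat.mul_le_mul_left _ hAM)
        _ ≤ k * (16 * Y ^ 4) := by rw [← add_mul]; exact Nat.mul_le_mul_right _ (by omega)
  have hcard : (#(siftedSet κ N A₀ M c u) : ℝ) =
      ∑ A ∈ residueSet κ A₀ M, (S A + S' A) * (T A + T' A) := by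
    rw [siftedSet, card_filter]
    push_cast
    refine sum_congr rfl fun A hA => ?_
    rw [(hST A hA).1, (hST A hA).2]
    split_ifs <;> simp_all
  have hdiff : |∑ A ∈ residueSet κ A₀ M, (S A + S' A) * (T A + T' A) -
      ∑ A ∈ residueSet κ A₀ M, S A * T A| ≤ ∑ A ∈ residueSet κ A₀ M, |S' A| +
        ∑ A ∈ residueSet κ A₀ M, |S A| * |T' A| := by
    rw [← sum_sub_distrib, ← sum_add_distrib]
    refine (abs_sum_le_sum_abs _ _).trans (sum_le_sum fun A hA => ?_)
    -- The split is asymmetric: T + T' is an indicator, so the tail S' needs no bound on T or T'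
    -- separately.
    have h1 : (S A + S' A) * (T A + T' A) - S A * T A = S' A * (T A + T' A) + S A * T' A := by ring
    rw [h1]
    refine (abs_add_le _ _).trans (add_le_add ?_ (abs_mul _ _).le)
    rw [abs_mul]
    refine mul_le_of_le_one_right (abs_nonneg _) ?_
    rw [(hST A hA).2]
    split_ifs <;> simp
  have h1 := sum_abs_sum_moebiusTerm_le (κ := κ) A₀ M hY E
  have h2 := sum_abs_mul_abs_moebiusTerm_le hκ hκN hu hc A₀ M hY E
  have h3 := abs_sum_moebiusTerm_mul_sub_le hκ hκN hu hc A₀ M Y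
  have h4 := abs_tsum_sieveWeight_sub_sum_le κ N hY
  have hκ1 : (1 : ℝ) ≤ (κ : ℝ) ^ 2 := one_le_pow₀ (by exact_mod_cast Nat.pos_of_ne_zero hκ)
  have hMκ : (M : ℝ) / (κ : ℝ) ^ 2 ≤ M := div_le_self (by positivity) hκ1
  have h5 : |(M : ℝ) / (κ : ℝ) ^ 2 * ∑ x ∈ Ioc 0 Y ×ˢ Ioc 0 Y, sieveWeight κ N x -
      M / (κ : ℝ) ^ 2 * ∑' x, sieveWeight κ N x| ≤ 5 * (M * (Y : ℝ)⁻¹) := by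
    rw [← mul_sub, abs_mul, abs_of_nonneg (by positivity : 0 ≤ (M : ℝ) / (κ : ℝ) ^ 2)]
    calc _ ≤ (M : ℝ) * (5 * (Y : ℝ)⁻¹) := mul_le_mul hMκ h4 (abs_nonneg _) (by positivity)
      _ = _ := by ring
  have hY1 : (1 : ℝ) ≤ Y := by exact_mod_cast hYpos
  have hMY : (M : ℝ) * (Y : ℝ)⁻¹ ≤ 16 * (Y : ℝ) ^ 3 := by
    rw [← div_eq_mul_inv, div_le_iff₀ (by positivity)]
    have : (M : ℝ) ≤ 16 * (Y : ℝ) ^ 4 := by exact_mod_cast hM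
    linarith [show 16 * (Y : ℝ) ^ 3 * Y = 16 * (Y : ℝ) ^ 4 by ring]
  have hYEeq : (Y : ℝ) * E = 4 * k * (Y : ℝ) ^ 3 := by
    rw [hE]
    push_cast
    ring
  have hY23 : ((A₀ : ℝ) + 1) * (Y : ℝ) ^ 2 ≤ (A₀ + 1) * (Y : ℝ) ^ 3 := by
    gcongr
    norm_num
  rw [hYEeq] at h2
  rw [hcard]
  calc _ ≤ |∑ A ∈ residueSet κ A₀ M, (S A + S' A) * (T A + T' A) -
          ∑ A ∈ residueSet κ A₀ M, S A * T A| +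
        |∑ A ∈ residueSet κ A₀ M, S A * T A -
          M / (κ : ℝ) ^ 2 * ∑ x ∈ Ioc 0 Y ×ˢ Ioc 0 Y, sieveWeight κ N x| +
        |(M : ℝ) / (κ : ℝ) ^ 2 * ∑ x ∈ Ioc 0 Y ×ˢ Ioc 0 Y, sieveWeight κ N x -
          M / (κ : ℝ) ^ 2 * ∑' x, sieveWeight κ N x| :=
        (abs_sub_le _ _ _).trans (add_le_add (abs_sub_le _ _ _) le_rfl)
    _ ≤ (M * (Y : ℝ)⁻¹ + (2 * (M * (Y : ℝ)⁻¹) + (A₀ + 1) * (4 * k * (Y : ℝ) ^ 3))) +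
        (A₀ + 1) * (Y : ℝ) ^ 2 + 5 * (M * (Y : ℝ)⁻¹) :=
        add_le_add (add_le_add (hdiff.trans (add_le_add h1 h2)) h3) h5
    _ ≤ _ := by linarith

end SieveCount

/-! ### The density as an Euler product -/

section EulerProduct

open ArithmeticFunction
open scoped ArithmeticFunction.Moebius

/-- The indicator function of the positive integers coprime to `N`. -/
noncomputable def coprimeIndicator (N : ℕ) : ArithmeticFunction ℝ :=
  ⟨fun d => if d ≠ 0 ∧ d.Coprime N then 1 else 0, by simp⟩

theorem coprimeIndicator_apply (N d : ℕ) :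
    coprimeIndicator N d = if d ≠ 0 ∧ d.Coprime N then 1 else 0 := rfl

theorem isMultiplicative_coprimeIndicator (N : ℕ) : (coprimeIndicator N).IsMultiplicative := by
  refine ⟨by simp [coprimeIndicator_apply], fun {m n} _ => ?_⟩
  simp only [coprimeIndicator_apply, mul_ne_zero_iff, Nat.coprime_mul_iff_left]
  split_ifs <;> simp_all

/-- The coefficient at `k` of the Dirichlet series obtained by grouping `sieveWeight` by the
product of the two indices. -/
noncomputable def sieveCoeff (κ N k : ℕ) : ℝ :=
  (μ k : ℝ) * (coprimeIndicator κ * coprimeIndicator N) k * ((k : ℝ) ^ 2)⁻¹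

theorem sieveCoeff_one (κ N : ℕ) : sieveCoeff κ N 1 = 1 := by
  have := ((isMultiplicative_coprimeIndicator κ).mul (isMultiplicative_coprimeIndicator N)).map_one
  simp [sieveCoeff, this]

theorem sieveCoeff_mul (κ N : ℕ) {a b : ℕ} (hab : a.Coprime b) :
    sieveCoeff κ N (a * b) = sieveCoeff κ N a * sieveCoeff κ N b := by
  simp only [sieveCoeff]
  rw [((isMultiplicative_coprimeIndicator κ).mul
      (isMultiplicative_coprimeIndicator N)).map_mul_of_coprime hab,
    isMultiplicative_moebius.map_mul_of_coprime hab]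
  push_cast
  ring

theorem sieveCoeff_prime_pow (κ N : ℕ) {p e : ℕ} (hp : p.Prime) (he : 2 ≤ e) :
    sieveCoeff κ N (p ^ e) = 0 := by
  rw [sieveCoeff, moebius_apply_prime_pow hp (by omega), if_neg (by omega)]
  simp

theorem sieveCoeff_prime (κ N : ℕ) {p : ℕ} (hp : p.Prime) :
    sieveCoeff κ N p =
      -((if p ∣ κ then 0 else 1) + if p ∣ N then 0 else 1) * ((p : ℝ) ^ 2)⁻¹ := by
  rw [sieveCoeff, moebius_apply_prime hp, mul_apply,
    Nat.sum_divisorsAntidiagonal (fun a b => coprimeIndicator κ a * coprimeIndicator N b),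
    Nat.Prime.sum_divisors hp, Nat.div_self hp.pos, Nat.div_one]
  simp only [coprimeIndicator_apply, Nat.Prime.coprime_iff_not_dvd hp]
  have := hp.ne_zero
  split_ifs <;> simp_all

/-- Grouping pairs by k = de turns the double series into one with multiplicative coefficients. The
infinite fibre over 0 vanishes because μ(0) = 0. -/
theorem tsum_fiber_sieveWeight (κ N k : ℕ) :
    ∑' x : (fun x : ℕ × ℕ => x.1 * x.2) ⁻¹' {k}, sieveWeight κ N x = sieveCoeff κ N k := by
  rcases Nat.eq_zero_or_pos k with rfl | hk
  · rw [sieveCoeff, ArithmeticFunction.map_zero, Int.cast_zero, zero_mul, zero_mul]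
    refine (tsum_congr fun x => ?_).trans tsum_zero
    have hx : x.1.1 * x.1.2 = 0 := x.2
    rw [sieveWeight, hx]
    simp
  · have hset : (fun x : ℕ × ℕ => x.1 * x.2) ⁻¹' {k} = ↑(k.divisorsAntidiagonal) := by
      ext x
      simp [Nat.mem_divisorsAntidiagonal, hk.ne']
    rw [hset, Finset.tsum_subtype' k.divisorsAntidiagonal (sieveWeight κ N), sieveCoeff, mul_apply,
      Finset.mul_sum, Finset.sum_mul]
    refine Finset.sum_congr rfl fun x hx => ?_
    obtain ⟨hx, -⟩ := Nat.mem_divisorsAntidiagonal.mp hx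
    have h1 : x.1 ≠ 0 := by rintro h; rw [h] at hx; omega
    have h2 : x.2 ≠ 0 := by rintro h; rw [h] at hx; omega
    rw [sieveWeight, ← hx, coprimeIndicator_apply, coprimeIndicator_apply]
    push_cast
    rw [mul_pow]
    split_ifs <;> simp_all [div_eq_mul_inv]

theorem hasSum_sieveCoeff (κ N : ℕ) :
    HasSum (sieveCoeff κ N) (∑' x, sieveWeight κ N x) := by
  have h := (summable_sieveWeight κ N).hasSum.tsum_fiberwise (fun x : ℕ × ℕ => x.1 * x.2)
  simpa only [tsum_fiber_sieveWeight] using h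

theorem hasProd_tsum_sieveWeight (κ N : ℕ) :
    HasProd (fun p : Nat.Primes =>
      1 - ((if (p : ℕ) ∣ κ then 0 else 1) + if (p : ℕ) ∣ N then 0 else 1) * ((p : ℝ) ^ 2)⁻¹)
      (∑' x, sieveWeight κ N x) := by
  have h0 := hasSum_sieveCoeff κ N
  have h := EulerProduct.eulerProduct_hasProd (f := sieveCoeff κ N) (sieveCoeff_one κ N)
    (fun {m n} hmn => sieveCoeff_mul κ N hmn) h0.summable.norm (by simp [sieveCoeff])
  rw [h0.tsum_eq] at h
  refine h.congr_fun fun p => ?_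
  rw [tsum_eq_sum (s := Finset.range 2) fun e he => sieveCoeff_prime_pow κ N p.2
    (by simpa [Nat.succ_le_iff] using he), Finset.sum_range_succ, Finset.sum_range_one, pow_zero, pow_one,
    sieveCoeff_one, sieveCoeff_prime κ N p.2]
  ring

theorem tsum_inv_sq : ∑' d : ℕ, ((d : ℝ) ^ 2)⁻¹ = (riemannZeta 2).re := by
  have h1 := hasSum_zeta_two.tsum_eq
  have h2 : (riemannZeta 2).re = Real.pi ^ 2 / 6 := by
    rw [riemannZeta_two]
    norm_cast
  rw [h2, ← h1]
  simp only [one_div]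

theorem hasProd_one_sub_inv_sq :
    HasProd (fun p : Nat.Primes => 1 - ((p : ℝ) ^ 2)⁻¹) ((riemannZeta 2).re)⁻¹ := by
  set f : ℕ →*₀ ℝ :=
    { toFun := fun d => ((d : ℝ) ^ 2)⁻¹
      map_zero' := by simp
      map_one' := by simp
      map_mul' := fun a b => by push_cast; rw [mul_pow, mul_inv] }
  have h := EulerProduct.eulerProduct_completely_multiplicative_hasProd (f := f)
    summable_inv_sq.norm
  have hf : ∑' d, f d = (riemannZeta 2).re := tsum_inv_sq
  rw [hf] at h
  have h0 : (riemannZeta 2).re ≠ 0 := by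
    rw [riemannZeta_two]
    norm_cast
    positivity
  exact (h.inv₀ h0).congr_fun fun p => by rw [inv_inv]; rfl

theorem four_le_sq_of_prime {p : ℕ} (hp : p.Prime) : (4 : ℝ) ≤ (p : ℝ) ^ 2 := by
  have : (2 : ℝ) ≤ p := by exact_mod_cast hp.two_le
  nlinarith

theorem multipliable_eulerFactor (N : ℕ) : Multipliable (eulerFactor N) := by
  have h : Summable fun p : {p : ℕ // p.Prime ∧ ¬ p ∣ N} => -(1 / ((p : ℝ) ^ 2 - 1)) := by
    refine Summable.neg (Summable.of_nonneg_of_le (fun p => ?_) (fun p => ?_)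
      ((summable_inv_sq.mul_left 2).subtype {p : ℕ | p.Prime ∧ ¬ p ∣ N}))
    · have := four_le_sq_of_prime p.2.1
      exact one_div_nonneg.mpr (by linarith)
    · have := four_le_sq_of_prime p.2.1
      change 1 / ((p : ℝ) ^ 2 - 1) ≤ 2 * ((p : ℝ) ^ 2)⁻¹
      rw [← div_eq_mul_inv, div_le_div_iff₀ (by linarith) (by linarith)]
      linarith
  exact (Real.multipliable_one_add_of_summable h).congr fun p => (sub_eq_add_neg _ _).symm

/-- The three products are compared prime by prime; for p ∤ N the identity is 1 - 2/p² = (1 -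
1/p²)(1 - 1/(p²-1)). -/
theorem tsum_sieveWeight {κ N : ℕ} (hκ : κ ≠ 0) (hκN : κ ∣ N) :
    ∑' x, sieveWeight κ N x = ((riemannZeta 2).re)⁻¹ *
      (∏ p ∈ κ.primeFactors, (1 - 1 / (p : ℝ) ^ 2)⁻¹) * ∏' p, eulerFactor N p := by
  set r₁ : Nat.Primes → ℝ := fun p => if (p : ℕ) ∣ κ then (1 - 1 / (p : ℝ) ^ 2)⁻¹ else 1 with hr₁
  set r₂ : Nat.Primes → ℝ := fun p => if (p : ℕ) ∣ N then 1 else 1 - 1 / ((p : ℝ) ^ 2 - 1) with hr₂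
  have h₁ : HasProd r₁ (∏ p ∈ κ.primeFactors, (1 - 1 / (p : ℝ) ^ 2)⁻¹) := by
    set s : Finset Nat.Primes := κ.primeFactors.subtype Nat.Prime
    have hs : ∏ p ∈ κ.primeFactors, (1 - 1 / (p : ℝ) ^ 2)⁻¹ = ∏ p ∈ s, r₁ p := by
      rw [← Finset.prod_subtype_of_mem (p := Nat.Prime) (fun p : ℕ => (1 - 1 / (p : ℝ) ^ 2)⁻¹)
        fun p hp => Nat.prime_of_mem_primeFactors hp]
      refine Finset.prod_congr rfl fun p hp => ?_
      rw [hr₁]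
      exact (if_pos (Nat.dvd_of_mem_primeFactors (Finset.mem_subtype.mp hp))).symm
    rw [hs]
    refine hasProd_prod_of_ne_finset_one fun p hp => if_neg fun h => hp ?_
    exact Finset.mem_subtype.mpr (Nat.mem_primeFactors.mpr ⟨p.2, h, hκ⟩)
  have h₂ : HasProd r₂ (∏' p, eulerFactor N p) := by
    set g : {p : ℕ // p.Prime ∧ ¬ p ∣ N} → Nat.Primes := fun p => ⟨p, p.2.1⟩
    have hg : Function.Injective g := fun p q h =>
      Subtype.ext (congrArg (Subtype.val : Nat.Primes → ℕ) h)
    refine (hg.hasProd_iff fun p hp => ?_).mp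
      ((multipliable_eulerFactor N).hasProd.congr_fun fun p => ?_)
    · by_contra h
      exact hp ⟨⟨p, p.2, fun hN => h (if_pos hN)⟩, rfl⟩
    · exact if_neg p.2.2
  refine (hasProd_tsum_sieveWeight κ N).unique
    (((hasProd_one_sub_inv_sq.mul h₁).mul h₂).congr_fun fun p => ?_)
  have hp := four_le_sq_of_prime p.2
  simp only [hr₁, hr₂]
  generalize (p : ℝ) ^ 2 = x at hp
  have hx0 : x ≠ 0 := by linarith
  have hx1 : x - 1 ≠ 0 := by linarith
  by_cases hpκ : (p : ℕ) ∣ κ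
  · rw [if_pos hpκ, if_pos hpκ, if_pos (hpκ.trans hκN), if_pos (hpκ.trans hκN)]
    have hx2 : 1 - x⁻¹ ≠ 0 := by
      field_simp
      exact div_ne_zero hx1 hx0
    rw [one_div, mul_inv_cancel₀ hx2]
    simp
  · rw [if_neg hpκ, if_neg hpκ]
    split_ifs
    · field_simp
      ring
    · field_simp
      ring

end EulerProduct

/-! ### Assembly of the asymptotic formula -/

/-- Beyond t^t the term in A dominates. The sieve therefore starts at A₀ = t^t, as its Möbius sums
need a nonzero value. -/
theorem discrForm_ne_zero {t A : ℕ} (ht : 2 ≤ t) (hA : t ^ t < A) : discrForm t A ≠ 0 := by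
  intro h
  have h1 := congrArg Int.natAbs (sub_eq_zero.mp h)
  have h2 : (t : ℤ) - 1 = (t - 1 : ℕ) := by rw [Nat.cast_sub (by omega), Nat.cast_one]
  rw [Int.natAbs_pow, Int.natAbs_neg, Int.natAbs_natCast, h2, Int.natAbs_mul, Int.natAbs_pow,
    Int.natAbs_natCast, Int.natAbs_natCast] at h1
  have h3 : 0 < (t - 1) ^ (t - 1) := pow_pos (by omega) _
  have h4 := Nat.le_mul_of_pos_left A h3
  omega

theorem mem_secondFamily_iff {m t A : ℕ} {X : ℝ} (hX : 0 ≤ X) (hn : 3 ≤ m * t) (hm : m ≠ 0)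
    (ht : 2 ≤ t) (h210 : UniqueFactorizationMonoid.radical m ∣ 210) (hA : t ^ t < A) :
    A ∈ secondFamily (m * t) m X ↔
      A ∈ siftedSet (UniqueFactorizationMonoid.radical m)
        (t * (t - 1) * UniqueFactorizationMonoid.radical m) (t ^ t) ⌊X⌋₊
        ((-(t : ℤ)) ^ t) (((t : ℤ) - 1) ^ (t - 1)) := by
  have hA1 : 1 < A := (Nat.one_lt_pow (by omega) (by omega)).trans hA
  have hlt : m < m * t := lt_mul_of_one_lt_right (Nat.pos_of_ne_zero hm) (by omega)
  rw [mem_siftedSet, Nat.le_floor_iff hX]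
  constructor
  · rintro ⟨-, hAX, hmod, hmon, -⟩
    exact ⟨⟨⟨hA, hAX⟩, hmod⟩,
      (isMonogenicPolynomial_trinomial_iff hm ht hA1 h210 hmod).mp hmon⟩
  · rintro ⟨⟨⟨-, hAX⟩, hmod⟩, h⟩
    exact ⟨by omega, hAX, hmod,
      (isMonogenicPolynomial_trinomial_iff hm ht hA1 h210 hmod).mpr h,
      not_squarefree_discr_trinomial hn hm hlt (by exact_mod_cast hA1)⟩

theorem abs_ncard_sub_card_le {S : Set ℕ} {T : Finset ℕ} {A₀ : ℕ} (h0 : 0 ∉ S)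
    (hT : ∀ A ∈ T, A₀ < A) (h : ∀ A, A₀ < A → (A ∈ S ↔ A ∈ T)) :
    |(S.ncard : ℝ) - T.card| ≤ A₀ := by
  classical
  have hsub : S ⊆ ↑(T ∪ Finset.Ioc 0 A₀) := by
    intro A hA
    rw [Finset.mem_coe, Finset.mem_union, Finset.mem_Ioc]
    by_cases hlt : A₀ < A
    · exact Or.inl ((h A hlt).mp hA)
    · refine Or.inr ⟨Nat.pos_of_ne_zero ?_, not_lt.mp hlt⟩
      rintro rfl
      exact h0 hA
  have hsup : (T : Set ℕ) ⊆ S := fun A hA => (h A (hT A hA)).mpr hA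
  have h1 : S.ncard ≤ T.card + A₀ := by
    refine (Set.ncard_le_ncard hsub (Finset.finite_toSet _)).trans ?_
    rw [Set.ncard_coe_finset]
    exact (Finset.card_union_le _ _).trans (by simp)
  have h2 : T.card ≤ S.ncard := by
    rw [← Set.ncard_coe_finset]
    exact Set.ncard_le_ncard hsup ((Finset.finite_toSet _).subset hsub)
  have h1' : (S.ncard : ℝ) ≤ T.card + A₀ := by exact_mod_cast h1
  have h2' : (T.card : ℝ) ≤ S.ncard := by exact_mod_cast h2
  rw [abs_of_nonneg (by linarith)]
  linarith

/-- A natural number approximating the fourth root of `X`. -/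
theorem exists_fourth_root_approx {X : ℝ} (hX : 1 ≤ X) :
    ∃ Y : ℕ, Y ≠ 0 ∧ ⌊X⌋₊ ≤ 16 * Y ^ 4 ∧ (Y : ℝ) ^ 3 ≤ X ^ (3 / 4 : ℝ) := by
  have hM : 1 ≤ ⌊X⌋₊ := Nat.le_floor (by exact_mod_cast hX)
  set M := ⌊X⌋₊ with hMdef
  set Z := Nat.sqrt M
  have hZ : 1 ≤ Z := Nat.sqrt_pos.mpr hM
  have hY : 1 ≤ Nat.sqrt Z := Nat.sqrt_pos.mpr hZ
  set Y := Nat.sqrt Z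
  have h1 : M < (Z + 1) * (Z + 1) := Nat.lt_succ_sqrt M
  have h2 : Z < (Y + 1) * (Y + 1) := Nat.lt_succ_sqrt Z
  have h3 : Z * Z ≤ M := Nat.sqrt_le M
  have h4 : Y * Y ≤ Z := Nat.sqrt_le Z
  refine ⟨Y, by omega, ?_, ?_⟩
  · have h5 : Z + 1 ≤ 4 * (Y * Y) := by nlinarith
    calc M ≤ (Z + 1) * (Z + 1) := h1.le
      _ ≤ (4 * (Y * Y)) * (4 * (Y * Y)) := Nat.mul_le_mul h5 h5
      _ = 16 * Y ^ 4 := by ring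
  · have h5 : Y ^ 4 ≤ M := by
      calc Y ^ 4 = (Y * Y) * (Y * Y) := by ring
        _ ≤ Z * Z := Nat.mul_le_mul h4 h4
        _ ≤ M := h3
    have h6 : (Y : ℝ) ^ 4 ≤ X := by
      have : ((Y ^ 4 : ℕ) : ℝ) ≤ M := by exact_mod_cast h5
      push_cast at this
      exact this.trans (Nat.floor_le (by linarith))
    have h7 : (Y : ℝ) ^ 3 = ((Y : ℝ) ^ 4) ^ (3 / 4 : ℝ) := by
      rw [← Real.rpow_natCast, ← Real.rpow_natCast, ← Real.rpow_mul (by positivity)]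
      norm_num
    rw [h7]
    exact Real.rpow_le_rpow (by positivity) h6 (by norm_num)

theorem theorem1p2 (n m t κ : ℕ) (hn : 3 ≤ n) (hm : 1 ≤ m) (hmn : m ∣ n) (hlt : m < n)
    (ht : t = n / m) (hκ : κ = UniqueFactorizationMonoid.radical m) (hκ210 : κ ∣ 210) :
    Multipliable (eulerFactor (t * (t - 1) * κ)) ∧
    ∃ C : ℝ, ∀ X : ℝ, 1 ≤ X →
      |((secondFamily n m X).ncard : ℝ) -
          X / ((κ : ℝ) ^ 2 * (riemannZeta 2).re) *
            (∏ p ∈ κ.primeFactors, (1 - 1 / (p : ℝ) ^ 2)⁻¹) *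
            ∏' p, eulerFactor (t * (t - 1) * κ) p| ≤
        C * X ^ (3 / 4 : ℝ) := by
  refine ⟨multipliable_eulerFactor _, ?_⟩
  obtain rfl : n = m * t := by rw [ht, Nat.mul_div_cancel' hmn]
  have ht2 : 2 ≤ t := by
    by_contra h
    have : m * t ≤ m * 1 := Nat.mul_le_mul_left m (by omega)
    omega
  have hm0 : m ≠ 0 := by omega
  have hκ0 : κ ≠ 0 := by rintro rfl; omega
  have hκN : κ ∣ t * (t - 1) * κ := dvd_mul_left _ _
  set N := t * (t - 1) * κ with hN
  have hcast : ((t - 1 : ℕ) : ℤ) = (t : ℤ) - 1 := by rw [Nat.cast_sub (by omega), Nat.cast_one]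
  have hu : ∀ e : ℕ, e.Coprime N → IsCoprime (e : ℤ) (((t : ℤ) - 1) ^ (t - 1)) := fun e he => by
    rw [← hcast]
    refine IsCoprime.pow_right (Nat.isCoprime_iff_coprime.mpr (he.coprime_dvd_right ?_))
    exact (dvd_mul_left _ _).mul_right κ
  have hc : ∀ e : ℕ, e.Coprime N → IsCoprime (e : ℤ) ((-(t : ℤ)) ^ t) := fun e he =>
    IsCoprime.pow_right (IsCoprime.neg_right (Nat.isCoprime_iff_coprime.mpr
      (he.coprime_dvd_right ((dvd_mul_right _ _).mul_right κ))))
  obtain ⟨K, hK, hsieve⟩ := exists_abs_card_siftedSet_sub_le hκ0 hκN hu hc (t ^ t)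
    fun A hA => discrForm_ne_zero ht2 hA
  set δ := ∑' x, sieveWeight κ N x with hδ
  -- The three terms account for A ≤ t^t, the sieve error, and the replacement of ⌊X⌋ by X.
  refine ⟨t ^ t + K + |δ|, fun X hX => ?_⟩
  obtain ⟨Y, hY, hXY, hYX⟩ := exists_fourth_root_approx hX
  set T := siftedSet κ N (t ^ t) ⌊X⌋₊ ((-(t : ℤ)) ^ t) (((t : ℤ) - 1) ^ (t - 1)) with hT
  have hκ1 : (1 : ℝ) ≤ (κ : ℝ) ^ 2 := one_le_pow₀ (by exact_mod_cast Nat.pos_of_ne_zero hκ0)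
  have hX1 : (1 : ℝ) ≤ X ^ (3 / 4 : ℝ) := Real.one_le_rpow hX (by norm_num)
  have hmain : X / ((κ : ℝ) ^ 2 * (riemannZeta 2).re) *
      (∏ p ∈ κ.primeFactors, (1 - 1 / (p : ℝ) ^ 2)⁻¹) * ∏' p, eulerFactor N p =
      X / (κ : ℝ) ^ 2 * δ := by
    rw [hδ, tsum_sieveWeight hκ0 hκN, ← div_div, div_eq_mul_inv _ (riemannZeta 2).re]
    ring
  have h1 : |((secondFamily (m * t) m X).ncard : ℝ) - T.card| ≤ (t ^ t : ℕ) := by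
    refine abs_ncard_sub_card_le (fun h => lt_irrefl 0 h.1) (fun A hA => ?_) fun A hA => ?_
    · exact (mem_siftedSet.mp hA).1.1.1
    · rw [hT, hN, hκ]
      exact mem_secondFamily_iff (by linarith) hn hm0 ht2 (hκ ▸ hκ210) hA
  have h2 : |(T.card : ℝ) - ⌊X⌋₊ / (κ : ℝ) ^ 2 * δ| ≤ K * X ^ (3 / 4 : ℝ) :=
    (hsieve Y _ hY hXY).trans (mul_le_mul_of_nonneg_left hYX hK)
  have h3 : |(⌊X⌋₊ : ℝ) / (κ : ℝ) ^ 2 * δ - X / (κ : ℝ) ^ 2 * δ| ≤ |δ| := by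
    rw [← sub_mul, ← sub_div, abs_mul]
    refine mul_le_of_le_one_left (abs_nonneg _) ?_
    rw [abs_div, abs_of_nonneg (by positivity : 0 ≤ (κ : ℝ) ^ 2)]
    have h4 : |(⌊X⌋₊ : ℝ) - X| ≤ 1 := by
      have h5 := Nat.floor_le (by linarith : 0 ≤ X)
      have h6 := Nat.lt_floor_add_one X
      rw [abs_le]
      constructor <;> linarith
    exact (div_le_self (abs_nonneg _) hκ1).trans h4
  rw [hmain]
  push_cast at h1
  have ht0 : (0 : ℝ) ≤ (t : ℝ) ^ t := by positivity
  calc _ ≤ |((secondFamily (m * t) m X).ncard : ℝ) - T.card| +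
        |(T.card : ℝ) - ⌊X⌋₊ / (κ : ℝ) ^ 2 * δ| +
        |(⌊X⌋₊ : ℝ) / (κ : ℝ) ^ 2 * δ - X / (κ : ℝ) ^ 2 * δ| :=
        (abs_sub_le _ _ _).trans (add_le_add (abs_sub_le _ _ _) le_rfl)
    _ ≤ (t : ℝ) ^ t * X ^ (3 / 4 : ℝ) + K * X ^ (3 / 4 : ℝ) + |δ| * X ^ (3 / 4 : ℝ) :=
        add_le_add (add_le_add (h1.trans (le_mul_of_one_le_right ht0 hX1)) h2)
          (h3.trans (le_mul_of_one_le_right (abs_nonneg _) hX1))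
    _ = _ := by ring
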